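/- Let $(M_1,g_1)$ be a nonempty smooth Lorentzian manifold of dimension $n_1$ (signature $(-,+,\dots,+)$) and $(M_2,g_2)$ a nonempty smooth Riemannian manifold of dimension $n_2\ge 1$, with $n=n_1+n_2\ge 4$. Let $M=M_1\times M_2$ carry the direct sum metric $g=g_1\oplus g_2$. For a metric in dimension $m$, $R_{abcd}$ is the Riemann tensor of its Levi-Civita connection, $R_{ab}=R^c{}_{acb}$ the Ricci tensor, $\mathcal R=R^a{}_a$ the Ricci scalar, and $C_{abcd}$ the Weyl tensor $$C_{abcd}=R_{abcd}-\tfrac{1}{m-2}\left(g_{ac}R_{db}-g_{ad}R_{cb}-g_{bc}R_{da}+g_{bd}R_{ca}\right)+\tfrac{\mathcal R}{(m-1)(m-2)}\left(g_{ac}g_{db}-g_{ad}g_{cb}\right)$$ if $m\ge 3$, and $C_{abcd}=0$ if $m\le 2$; quantities of the factor $M_i$ carry the superscript $(n_i)$. For a unit timelike vector $u$ at a point ($g(u,u)=-1$) let $\theta$ be the reflection $u\mapsto -u$, $x\mapsto x$ for $x\perp u$. At that point $C$ is *purely magnetic (PM) with respect to $u$* if its electric part $C_+=\frac12(C+\theta(C))$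 vanishes, where $\theta(C)(a,b,c,d)=C(\theta a,\theta b,\theta c,\theta d)$, and *properly PM* if moreover $C\ne 0$. A manifold is (properly) PM with respect to a field of unit timelike vectors if this holds at every point. A tangent vector of $M$ *lives in $M_1$* if it is the uplift of a vector tangent to $M_1$; it is then identified with that vector. **(1)** Suppose $n_1\ge 2$ and let $U$ be a field of unit timelike vectors on $M$ that lives in $M_1$, so $U(p)\in T_{p_1}M_1$ for $p=(p_1,p_2)\in M$ (for instance, a field on $M_1$). Then $M$ is PM with respect to $U$ if and only if the following three conditions hold: - (a) $M_1$ is PM with respect to $U$ and has Ricci tensor of the form $R^{(n_1)}_{ab}=\frac{\mathcal R^{(n_1)}}{n_1}\,g^{(n_1)}_{ab}+U_{(a}q_{b)}$ with $U^aq_a=0$ for some $q$ (that is, for every $p\in M$ both hold at $p_1$ with $U=U(p)$); - (b) $M_2$ has constant curvature, i.e. $R^{(n_2)}_{abcd}=K(g_{ac}g_{bd}-g_{ad}g_{bc})$ on $M_2$ for some constant $K$, where $g=g^{(n_2)}$; - (c) $n_2(n_2-1)\mathcal R^{(n_1)}(p_1)+n_1(n_1-1)\mathcal R^{(n_2)}(p_2)=0$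 for all $(p_1,p_2)\in M$. In this case, for all $A,B,D\in T_{p_1}M_1$ orthogonal to $U$ and all $X,Y,Z\in T_{p_2}M_2$, the magnetic Weyl components of $M$ are given by $$C(U,X,A,Y)=-\tfrac{1}{n-2}\,R^{(n_1)}(U,A)\,g_2(X,Y),$$ $$C(U,A,B,D)=C^{(n_1)}(U,A,B,D)-\tfrac{n_2}{(n-2)(n_1-2)}\left(g_1(A,B)R^{(n_1)}(D,U)-g_1(A,D)R^{(n_1)}(B,U)\right)\quad\text{if } n_1\ge 3,$$ and $C(U,X,A,B)=C(U,A,B,X)=C(U,A,X,Y)=C(U,X,Y,Z)=0$. **(2)** If at a point $p\in M$ the Weyl tensor of $M$ is properly PM with respect to a unit timelike vector $u\in T_pM$, then $n_1\ge 3$ and $u$ lives in $M_1$. In particular, if $M$ is properly PM with respect to a field $u$ of unit timelike vectors, then $n_1\ge3$ and $u$ lives in $M_1$ everywhere. -/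

import Mathlib

set_option maxSynthPendingDepth 3

open scoped Manifold ContDiff

noncomputable section

namespace PMProduct

section Geometry

variable {E : Type*} [NormedAddCommGroup E] [NormedSpace ℝ E]
  {H : Type*} [TopologicalSpace H] {I : ModelWithCorners ℝ E H}
  {M : Type*} [TopologicalSpace M] [ChartedSpace H M]

/-- A smooth Lorentzian metric of signature `(-,+,…,+)` on a manifold: a smooth field of symmetric
bilinear forms on the tangent spaces, such that every tangent space contains a timelike vector
whose orthogonal complement is positive definite. -/
structure LorentzianMetric (I : ModelWithCorners ℝ E H) (M : Type*) [TopologicalSpace M]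
    [ChartedSpace H M] [IsManifold I ∞ M] where
  /-- The bilinear form on each tangent space. -/
  inner (x : M) : TangentSpace I x →L[ℝ] TangentSpace I x →L[ℝ] ℝ
  symm (x : M) (v w : TangentSpace I x) : inner x v w = inner x w v
  signature (x : M) : ∃ t : TangentSpace I x, inner x t t < 0 ∧
    ∀ v : TangentSpace I x, inner x t v = 0 → v ≠ 0 → 0 < inner x v v
  contMDiff : ContMDiff I (I.prod 𝓘(ℝ, E →L[ℝ] E →L[ℝ] ℝ)) ∞
    (fun x ↦ Bundle.TotalSpace.mk' (E →L[ℝ] E →L[ℝ] ℝ)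
      (E := fun x ↦ TangentSpace I x →L[ℝ] TangentSpace I x →L[ℝ] ℝ) x (inner x))

/-- The coordinate expression at `y : E` of a field `g` of bilinear forms, in the preferred chart
`φ` at `x`: `(v, w) ↦ g (dφ⁻¹ v, dφ⁻¹ w)`, with `g` and `dφ⁻¹` taken at `φ⁻¹ y` and `y`. -/
def chartMetric (g : ∀ x : M, TangentSpace I x →L[ℝ] TangentSpace I x →L[ℝ] ℝ) (x : M) (y : E) :
    E →L[ℝ] E →L[ℝ] ℝ :=
  ContinuousLinearMap.bilinearComp (E := E) (F := E) (E' := E) (F' := E) (G := ℝ)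
    (g ((extChartAt I x).symm y))
    (mfderiv 𝓘(ℝ, E) I (extChartAt I x).symm y)
    (mfderiv 𝓘(ℝ, E) I (extChartAt I x).symm y)

/-- Christoffel symbols of the first kind of a metric `G` given on (an open part of) `E`, at `y`;
see `christoffelFirst_apply`. -/
def christoffelFirst (G : E → E →L[ℝ] E →L[ℝ] ℝ) (y : E) : E →L[ℝ] E →L[ℝ] E →L[ℝ] ℝ :=
  let D : E →L[ℝ] E →L[ℝ] E →L[ℝ] ℝ := fderiv ℝ G y
  let flip₂₃ : (E →L[ℝ] E →L[ℝ] ℝ) →L[ℝ] (E →L[ℝ] E →L[ℝ] ℝ) :=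
    (ContinuousLinearMap.flipₗᵢ ℝ E E ℝ).toContinuousLinearEquiv
  (1 / 2 : ℝ) • (D + D.flip - flip₂₃.comp D.flip)

theorem christoffelFirst_apply (G : E → E →L[ℝ] E →L[ℝ] ℝ) (y v w z : E) :
    christoffelFirst G y v w z =
      (1 / 2) * (fderiv ℝ G y v w z + fderiv ℝ G y w v z - fderiv ℝ G y z v w) := by
  simp [christoffelFirst]

/-- Christoffel symbols of the second kind: `christoffel G y v w` is the vector obtained by raising
the last index of `christoffelFirst G y v w` with the inverse of `G y : E → E*`. -/
def christoffel (G : E → E →L[ℝ] E →L[ℝ] ℝ) (y : E) : E →L[ℝ] E →L[ℝ] E :=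
  (ContinuousLinearMap.compL ℝ E (E →L[ℝ] ℝ) E (ContinuousLinearMap.inverse (G y))).comp
    (christoffelFirst G y)

theorem christoffel_apply (G : E → E →L[ℝ] E →L[ℝ] ℝ) (y v w : E) :
    christoffel G y v w = ContinuousLinearMap.inverse (G y) (christoffelFirst G y v w) := by
  simp [christoffel]

/-- The curvature operator `R(c, d) b = ∇_c ∇_d b - ∇_d ∇_c b` of a metric `G` on (an open part of)
`E`, for constant coordinate fields `b, c, d`, as a linear function of `c`. -/
def chartCurvature (G : E → E →L[ℝ] E →L[ℝ] ℝ) (y : E) (d b : E) : E →ₗ[ℝ] E where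
  toFun c := fderiv ℝ (christoffel G) y c d b - fderiv ℝ (christoffel G) y d c b
    + christoffel G y c (christoffel G y d b) - christoffel G y d (christoffel G y c b)
  map_add' c c' := by simp; abel
  map_smul' r c := by simp [smul_sub, smul_add]

/-- The Ricci tensor `R_{ab} = R^c_{acb}` of a metric `G` on (an open part of) `E`: the trace of
`c ↦ R(c, b) a`. -/
def chartRicci (G : E → E →L[ℝ] E →L[ℝ] ℝ) (y : E) : E →ₗ[ℝ] E →ₗ[ℝ] ℝ :=
  LinearMap.mk₂ ℝ (fun a b ↦ LinearMap.trace ℝ E (chartCurvature G y b a))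
    (fun a a' b ↦ by
      rw [← map_add]; congr 1; ext c
      simp [chartCurvature]; abel)
    (fun r a b ↦ by
      rw [← map_smul]; congr 1; ext c
      simp [chartCurvature, smul_sub, smul_add])
    (fun a b b' ↦ by
      rw [← map_add]; congr 1; ext c
      simp [chartCurvature]; abel)
    (fun r a b ↦ by
      rw [← map_smul]; congr 1; ext c
      simp [chartCurvature, smul_sub, smul_add])

/-- The Ricci scalar `R^a_a` of a metric `G` on (an open part of) `E`: the trace of the Ricci tensor
with one index raised by the inverse of `G y : E → E*`. -/
def chartScalarCurvature [FiniteDimensional ℝ E] (G : E → E →L[ℝ] E →L[ℝ] ℝ) (y : E) : ℝ :=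
  LinearMap.trace ℝ E
    ((ContinuousLinearMap.inverse (G y)).toLinearMap ∘ₗ
      (LinearMap.toContinuousLinearMap : (E →ₗ[ℝ] ℝ) ≃ₗ[ℝ] (E →L[ℝ] ℝ)).toLinearMap ∘ₗ
      chartRicci G y)

/-- The Riemann tensor `R_{abcd} = g(a, R(c, d) b)` of the metric `g` at `x`. By Mathlib's
definition, `TangentSpace I x` is the model space `E`, a tangent vector at `x` being represented by
its components in the preferred chart at `x`. -/
def riemann (g : ∀ x : M, TangentSpace I x →L[ℝ] TangentSpace I x →L[ℝ] ℝ) (x : M)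
    (a b c d : TangentSpace I x) : ℝ :=
  g x a (chartCurvature (chartMetric g x) (extChartAt I x x) d b c)

/-- The Ricci tensor `R_{ab} = R^c_{acb}` of `g` at `x`. -/
def ricci (g : ∀ x : M, TangentSpace I x →L[ℝ] TangentSpace I x →L[ℝ] ℝ) (x : M)
    (a b : TangentSpace I x) : ℝ :=
  chartRicci (chartMetric g x) (extChartAt I x x) a b

/-- The Ricci scalar `R^a_a` of `g` at `x`. -/
def scalarCurvature [FiniteDimensional ℝ E]
    (g : ∀ x : M, TangentSpace I x →L[ℝ] TangentSpace I x →L[ℝ] ℝ) (x : M) : ℝ :=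
  chartScalarCurvature (chartMetric g x) (extChartAt I x x)

/-- The Weyl tensor
`C_{abcd} = R_{abcd} - (1/(n-2)) (g_{ac} R_{db} - g_{ad} R_{cb} - g_{bc} R_{da} + g_{bd} R_{ca})
  + (R/((n-1)(n-2))) (g_{ac} g_{db} - g_{ad} g_{cb})`
of a metric in dimension `n ≥ 3`; by convention it vanishes in dimension `n ≤ 2`. -/
def weyl [FiniteDimensional ℝ E]
    (g : ∀ x : M, TangentSpace I x →L[ℝ] TangentSpace I x →L[ℝ] ℝ) (x : M)
    (a b c d : TangentSpace I x) : ℝ :=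
  if Module.finrank ℝ E ≤ 2 then 0 else
    riemann g x a b c d
      - 1 / ((Module.finrank ℝ E : ℝ) - 2) *
        (g x a c * ricci g x d b - g x a d * ricci g x c b
          - g x b c * ricci g x d a + g x b d * ricci g x c a)
      + scalarCurvature g x / (((Module.finrank ℝ E : ℝ) - 1) * ((Module.finrank ℝ E : ℝ) - 2)) *
        (g x a c * g x d b - g x a d * g x c b)

/-- The metric `g` has constant curvature:
`R_{abcd} = K (g_{ac} g_{bd} - g_{ad} g_{bc})` for a constant `K`. -/
def HasConstantCurvature
    (g : ∀ x : M, TangentSpace I x →L[ℝ] TangentSpace I x →L[ℝ] ℝ) : Prop :=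
  ∃ K : ℝ, ∀ (x : M) (a b c d : TangentSpace I x),
    riemann g x a b c d = K * (g x a c * g x b d - g x a d * g x b c)

/-- The reflection `θ` of a tangent space determined by a unit timelike vector `u`
(`g(u, u) = -1`): `u ↦ -u`, and `v ↦ v` for `v` orthogonal to `u`. -/
def timeReflection (g : ∀ x : M, TangentSpace I x →L[ℝ] TangentSpace I x →L[ℝ] ℝ) (x : M)
    (u v : TangentSpace I x) : TangentSpace I x :=
  v + (2 * g x u v) • u

/-- The electric part `C_+ = (C + θ(C)) / 2` of the Weyl tensor at `x` with respect to the unit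
timelike vector `u`. -/
def weylElectric [FiniteDimensional ℝ E]
    (g : ∀ x : M, TangentSpace I x →L[ℝ] TangentSpace I x →L[ℝ] ℝ) (x : M)
    (u a b c d : TangentSpace I x) : ℝ :=
  (weyl g x a b c d + weyl g x (timeReflection g x u a) (timeReflection g x u b)
    (timeReflection g x u c) (timeReflection g x u d)) / 2

/-- The Weyl tensor at `x` is purely magnetic (PM) with respect to the unit timelike vector `u`:
its electric part vanishes. -/
def IsPMAt [FiniteDimensional ℝ E]
    (g : ∀ x : M, TangentSpace I x →L[ℝ] TangentSpace I x →L[ℝ] ℝ) (x : M)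
    (u : TangentSpace I x) : Prop :=
  ∀ a b c d : TangentSpace I x, weylElectric g x u a b c d = 0

/-- The Weyl tensor at `x` is properly PM with respect to `u`: it is PM and nonzero. -/
def IsProperlyPMAt [FiniteDimensional ℝ E]
    (g : ∀ x : M, TangentSpace I x →L[ℝ] TangentSpace I x →L[ℝ] ℝ) (x : M)
    (u : TangentSpace I x) : Prop :=
  IsPMAt g x u ∧ ∃ a b c d : TangentSpace I x, weyl g x a b c d ≠ 0

/-- At `x` the Ricci tensor has the form `R_{ab} = (R/n) g_{ab} + U_{(a} q_{b)}` with `q`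
orthogonal to `U`. -/
def HasPMRicciFormAt [FiniteDimensional ℝ E]
    (g : ∀ x : M, TangentSpace I x →L[ℝ] TangentSpace I x →L[ℝ] ℝ) (x : M)
    (U : TangentSpace I x) : Prop :=
  ∃ q : TangentSpace I x, g x U q = 0 ∧ ∀ a b : TangentSpace I x,
    ricci g x a b = scalarCurvature g x / (Module.finrank ℝ E : ℝ) * g x a b
      + 1 / 2 * (g x U a * g x q b + g x U b * g x q a)

end Geometry

section Product

variable {E₁ : Type*} [NormedAddCommGroup E₁] [NormedSpace ℝ E₁]
  {H₁ : Type*} [TopologicalSpace H₁] {I₁ : ModelWithCorners ℝ E₁ H₁}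
  {M₁ : Type*} [TopologicalSpace M₁] [ChartedSpace H₁ M₁]
  {E₂ : Type*} [NormedAddCommGroup E₂] [NormedSpace ℝ E₂]
  {H₂ : Type*} [TopologicalSpace H₂] {I₂ : ModelWithCorners ℝ E₂ H₂}
  {M₂ : Type*} [TopologicalSpace M₂] [ChartedSpace H₂ M₂]

/-- The direct sum metric `g₁ ⊕ g₂` on `M₁ × M₂`; the tangent space of the product manifold at `p`
is `T_{p.1} M₁ × T_{p.2} M₂`. -/
def prodMetric (g₁ : ∀ x : M₁, TangentSpace I₁ x →L[ℝ] TangentSpace I₁ x →L[ℝ] ℝ)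
    (g₂ : ∀ x : M₂, TangentSpace I₂ x →L[ℝ] TangentSpace I₂ x →L[ℝ] ℝ) (p : M₁ × M₂) :
    TangentSpace (I₁.prod I₂) p →L[ℝ] TangentSpace (I₁.prod I₂) p →L[ℝ] ℝ :=
  ContinuousLinearMap.bilinearComp (E := E₁) (F := E₁) (G := ℝ) (g₁ p.1)
      (ContinuousLinearMap.fst ℝ E₁ E₂) (ContinuousLinearMap.fst ℝ E₁ E₂)
    + ContinuousLinearMap.bilinearComp (E := E₂) (F := E₂) (G := ℝ) (g₂ p.2)
      (ContinuousLinearMap.snd ℝ E₁ E₂) (ContinuousLinearMap.snd ℝ E₁ E₂)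

/-- The uplift to `M₁ × M₂` of a vector tangent to `M₁`. -/
def liftFst (p : M₁ × M₂) (v : TangentSpace I₁ p.1) : TangentSpace (I₁.prod I₂) p :=
  ((v, 0) : E₁ × E₂)

/-- The uplift to `M₁ × M₂` of a vector tangent to `M₂`. -/
def liftSnd (p : M₁ × M₂) (v : TangentSpace I₂ p.2) : TangentSpace (I₁.prod I₂) p :=
  ((0, v) : E₁ × E₂)

/-- A vector tangent to `M₁ × M₂` lives in `M₁`: it is the uplift of a vector tangent to `M₁`. -/
def LivesInFst (p : M₁ × M₂) (u : TangentSpace (I₁.prod I₂) p) : Prop :=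
  ∃ v : TangentSpace I₁ p.1, u = liftFst p v

end Product

end PMProduct

end

/-! In a product chart the metric is block diagonal, so the Christoffel symbols, and with them the
Riemann and Ricci tensors and the Ricci scalar, are direct sums over the factors
(`chartCurvature_directSum`, `riemann_prodMetric`). The theorem thereby becomes linear algebra on `T
M₁ × T M₂` at each point, using only the relations collected in `IsCurvatureAt`.

Reflection in `u` multiplies a component of `C` by `-1` for each argument `u`. Hence purely magnetic
means that the components with an even number of `u`'s vanish, that is, `C(u,A,u,B)` and
`C(A,B,D,F)` for arguments orthogonal to `u` (`isPMForm_iff`).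

For (1), the product of spaces of constant curvature `κ` and `-κ` is conformally flat. `PMFactors`
says that the even components of the curvature are those of such a product, which leaves only the
part of `Ric₁` pairing `U` with its complement and the odd components of `R₁` free. This is
equivalent to PM (`PMFactors.isPMForm`, `exists_pmFactors_of_isPMForm`), and conditions (a)-(c)
express the same thing without `κ` (`PMFactors.isPMForm_fst`, `exists_pmFactors`). Constancy over
`M₂` comes for free: `κ` is determined by the scalar curvature of `M₁`, which does not see the point
of `M₂`.

For (2), suppose `u = (u₁, u₂)` with `u₂ ≠ 0`. The plane spanned by `(u₁, 0)` and `(0, u₂)` then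
contains a vector orthogonal to `u`, and comparing the vanishing components along both vectors kills
the whole Weyl tensor (`prodWeyl_eq_zero_of_snd_ne_zero`). If `u` lives in `M₁` and `n₁ ≤ 2`, then
`R₁` and `Ric₁` are built from `g₁` alone, so the magnetic components vanish too
(`prodWeyl_eq_zero_of_finrank_le_two`). -/

noncomputable section

namespace PMProduct

open Filter Topology

/-! ### Curvature of a metric in coordinates. -/

section Local

variable {E : Type*} [NormedAddCommGroup E] [NormedSpace ℝ E]

/-- `G` is a pseudo-Riemannian metric of class `C^2` near `y`. -/
structure IsMetricNear (G : E → E →L[ℝ] E →L[ℝ] ℝ) (y : E) : Prop where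
  contDiffAt : ContDiffAt ℝ 2 G y
  symm : ∀ᶠ z in 𝓝 y, ∀ v w, G z v w = G z w v
  isInvertible : (G y).IsInvertible

namespace IsMetricNear

variable {G : E → E →L[ℝ] E →L[ℝ] ℝ} {y : E}

theorem hasFDerivAt (hG : IsMetricNear G y) : HasFDerivAt G (fderiv ℝ G y) y :=
  (hG.contDiffAt.differentiableAt (by norm_num)).hasFDerivAt

theorem hasFDerivAt_fderiv (hG : IsMetricNear G y) :
    HasFDerivAt (fderiv ℝ G) (fderiv ℝ (fderiv ℝ G) y) y :=
  ((hG.contDiffAt.fderiv_right (m := 1) (by norm_num)).differentiableAt (by norm_num)).hasFDerivAt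

theorem fderiv_symm (hG : IsMetricNear G y) :
    ∀ᶠ z in 𝓝 y, ∀ u v w, fderiv ℝ G z u v w = fderiv ℝ G z u w v := by
  have h1 : ∀ᶠ z in 𝓝 y, ContDiffAt ℝ 2 G z := hG.contDiffAt.eventually (by simp)
  filter_upwards [h1, hG.symm.eventually_nhds] with z hz hs u v w
  have hd := (hz.differentiableAt (by norm_num)).hasFDerivAt
  have e1 : HasFDerivAt (fun x ↦ G x v w) _ z :=
    (hd.clm_apply (hasFDerivAt_const v z)).clm_apply (hasFDerivAt_const w z)
  have e2 : HasFDerivAt (fun x ↦ G x w v) _ z :=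
    (hd.clm_apply (hasFDerivAt_const w z)).clm_apply (hasFDerivAt_const v z)
  have e3 := e1.unique (e2.congr_of_eventuallyEq (hs.mono fun x hx ↦ hx v w))
  simpa using congr($e3 u)

theorem fderiv_fderiv_symm (hG : IsMetricNear G y) (t u v w : E) :
    fderiv ℝ (fderiv ℝ G) y t u v w = fderiv ℝ (fderiv ℝ G) y t u w v := by
  have e1 : HasFDerivAt (fun x ↦ fderiv ℝ G x u v w) _ y :=
    ((hG.hasFDerivAt_fderiv.clm_apply (hasFDerivAt_const u y)).clm_apply
      (hasFDerivAt_const v y)).clm_apply (hasFDerivAt_const w y)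
  have e2 : HasFDerivAt (fun x ↦ fderiv ℝ G x u w v) _ y :=
    ((hG.hasFDerivAt_fderiv.clm_apply (hasFDerivAt_const u y)).clm_apply
      (hasFDerivAt_const w y)).clm_apply (hasFDerivAt_const v y)
  have e3 := e1.unique (e2.congr_of_eventuallyEq (hG.fderiv_symm.mono fun x hx ↦ hx u v w))
  simpa using congr($e3 t)

theorem fderiv_fderiv_comm (hG : IsMetricNear G y) (t u v w : E) :
    fderiv ℝ (fderiv ℝ G) y t u v w = fderiv ℝ (fderiv ℝ G) y u t v w := by
  have := hG.contDiffAt.isSymmSndFDerivAt (by simp)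
  exact congr($(this t u) v w)

theorem eventually_isInvertible [CompleteSpace E] (hG : IsMetricNear G y) :
    ∀ᶠ z in 𝓝 y, (G z).IsInvertible := by
  obtain ⟨e, he⟩ := hG.isInvertible
  have h := ContinuousLinearEquiv.nhds e
  rw [he] at h
  exact hG.contDiffAt.continuousAt.eventually h

theorem differentiableAt_christoffelFirst (hG : IsMetricNear G y) :
    DifferentiableAt ℝ (christoffelFirst G) y := by
  have h := hG.hasFDerivAt_fderiv.differentiableAt
  have hf : DifferentiableAt ℝ (fun z ↦ (fderiv ℝ G z).flip) y :=
    ((ContinuousLinearMap.flipₗᵢ ℝ E E (E →L[ℝ] ℝ)).toContinuousLinearEquiv.differentiable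
      |>.differentiableAt).comp y h
  unfold christoffelFirst
  exact (((h.add hf).sub ((differentiableAt_const _).clm_comp hf)).const_smul (1 / 2 : ℝ))

theorem differentiableAt_christoffel [CompleteSpace E] (hG : IsMetricNear G y) :
    DifferentiableAt ℝ (christoffel G) y := by
  have hi : DifferentiableAt ℝ (fun z ↦ ContinuousLinearMap.inverse (G z)) y :=
    (hG.isInvertible.contDiffAt_map_inverse (n := 1)).differentiableAt (by norm_num) |>.comp y
      hG.hasFDerivAt.differentiableAt
  have hc : DifferentiableAt ℝ (fun z ↦ ContinuousLinearMap.compL ℝ E (E →L[ℝ] ℝ) E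
      (ContinuousLinearMap.inverse (G z))) y :=
    (ContinuousLinearMap.compL ℝ E (E →L[ℝ] ℝ) E).differentiableAt.comp y hi
  exact hc.clm_comp hG.differentiableAt_christoffelFirst

theorem apply_christoffel {z : E} (hz : (G z).IsInvertible) (v w a : E) :
    G z (christoffel G z v w) a = christoffelFirst G z v w a := by
  rw [christoffel_apply]
  obtain ⟨e, he⟩ := hz
  simp [← he]

/-- Obtained by differentiating the identity `apply_christoffel`, so that the derivative of the
inverse metric never has to be computed. -/
theorem apply_fderiv_christoffel [CompleteSpace E] (hG : IsMetricNear G y) (c d b a : E) :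
    G y (fderiv ℝ (christoffel G) y c d b) a =
      1 / 2 * (fderiv ℝ (fderiv ℝ G) y c d b a + fderiv ℝ (fderiv ℝ G) y c b d a
        - fderiv ℝ (fderiv ℝ G) y c a d b) - fderiv ℝ G y c (christoffel G y d b) a := by
  have hΓ := hG.differentiableAt_christoffel.hasFDerivAt
  have h2 := hG.hasFDerivAt_fderiv
  have k (v : E) := hasFDerivAt_const (𝕜 := ℝ) v y
  have e1 : HasFDerivAt (fun z ↦ G z (christoffel G z d b) a) _ y :=
    (hG.hasFDerivAt.clm_apply ((hΓ.clm_apply (k d)).clm_apply (k b))).clm_apply (k a)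
  have e2 : HasFDerivAt (fun z ↦ 1 / 2 * (fderiv ℝ G z d b a + fderiv ℝ G z b d a
      - fderiv ℝ G z a d b)) _ y :=
    (((((h2.clm_apply (k d)).clm_apply (k b)).clm_apply (k a)).add
      (((h2.clm_apply (k b)).clm_apply (k d)).clm_apply (k a))).sub
      (((h2.clm_apply (k a)).clm_apply (k d)).clm_apply (k b))).const_mul _
  have e3 := e1.unique (e2.congr_of_eventuallyEq (hG.eventually_isInvertible.mono fun z hz ↦ by
    simp only [apply_christoffel hz, christoffelFirst_apply]))
  have e4 := congr($e3 c)
  simp at e4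
  simp
  linarith

theorem fderiv_eq [CompleteSpace E] (hG : IsMetricNear G y) (c v w : E) :
    fderiv ℝ G y c v w = G y (christoffel G y c v) w + G y (christoffel G y c w) v := by
  have s := hG.fderiv_symm.self_of_nhds
  rw [apply_christoffel hG.isInvertible, apply_christoffel hG.isInvertible,
    christoffelFirst_apply, christoffelFirst_apply, s v c w, s c w v, s w c v]
  ring

/-- The Riemann tensor in terms of second derivatives of the metric and Christoffel symbols. -/
theorem apply_chartCurvature [CompleteSpace E] (hG : IsMetricNear G y) (a b c d : E) :
    G y a (chartCurvature G y d b c) =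
      1 / 2 * (fderiv ℝ (fderiv ℝ G) y c b d a - fderiv ℝ (fderiv ℝ G) y c a d b
        - fderiv ℝ (fderiv ℝ G) y d b c a + fderiv ℝ (fderiv ℝ G) y d a c b)
      - G y (christoffel G y c a) (christoffel G y d b)
      + G y (christoffel G y d a) (christoffel G y c b) := by
  have s := hG.symm.self_of_nhds
  have hc := hG.fderiv_fderiv_comm c d b a
  rw [s]
  simp only [chartCurvature, LinearMap.coe_mk, AddHom.coe_mk, map_add, map_sub,
    add_apply, sub_apply, apply_fderiv_christoffel hG, hG.fderiv_eq]
  linarith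

theorem christoffel_comm (hG : IsMetricNear G y) (v w : E) :
    christoffel G y v w = christoffel G y w v := by
  rw [christoffel_apply, christoffel_apply]
  congr 1
  ext a
  rw [christoffelFirst_apply, christoffelFirst_apply, hG.fderiv_symm.self_of_nhds a v w]
  ring

end IsMetricNear

theorem chartRicci_apply (G : E → E →L[ℝ] E →L[ℝ] ℝ) (y a b : E) :
    chartRicci G y a b = LinearMap.trace ℝ E (chartCurvature G y b a) := rfl

end Local

/-! ### Pointwise algebraic relations satisfied by curvature. -/

section Algebra

variable {V : Type*} [AddCommGroup V] [Module ℝ V]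

/-- A symmetric bilinear form, as a function of two variables. -/
structure IsSymmForm (h : V → V → ℝ) : Prop where
  add_left (a a' b : V) : h (a + a') b = h a b + h a' b
  smul_left (r : ℝ) (a b : V) : h (r • a) b = r * h a b
  symm (a b : V) : h a b = h b a

/-- A quadrilinear form with the symmetries `R_{abcd} = -R_{bacd} = R_{cdab}`. -/
structure IsCurvatureForm (R : V → V → V → V → ℝ) : Prop where
  add₁ (a a' b c d : V) : R (a + a') b c d = R a b c d + R a' b c d
  smul₁ (r : ℝ) (a b c d : V) : R (r • a) b c d = r * R a b c d
  anti₁₂ (a b c d : V) : R a b c d = -R b a c d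
  pair (a b c d : V) : R a b c d = R c d a b

/-- The algebraic relations between a metric `g`, its Riemann tensor `R`, Ricci tensor `Ric` and
Ricci scalar `s` at a point. -/
structure IsCurvatureAt (g : V → V → ℝ) (R : V → V → V → V → ℝ) (Ric : V → V → ℝ) (s : ℝ) :
    Prop where
  metric : IsSymmForm g
  riemann : IsCurvatureForm R
  ricci : IsSymmForm Ric
  exists_dual (f : V →ₗ[ℝ] ℝ) : ∃ r, ∀ a, g r a = f a
  scalar_eq (μ : ℝ) (U q : V)
    (h : ∀ a b, Ric a b = μ * g a b + 1 / 2 * (g U a * g q b + g U b * g q a)) :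
    s = Module.finrank ℝ V * μ + g U q
  ricci_eq (K : ℝ) (h : ∀ a b c d, R a b c d = K * (g a c * g b d - g a d * g b c)) (a b : V) :
    Ric a b = K * (Module.finrank ℝ V - 1) * g a b

end Algebra

/-! ### The coordinate curvature satisfies the algebraic relations. -/

section Local

variable {E : Type*} [NormedAddCommGroup E] [NormedSpace ℝ E] [FiniteDimensional ℝ E]

theorem isInvertible_of_nondegenerate {g : E →L[ℝ] E →L[ℝ] ℝ}
    (h : ∀ v, (∀ w, g v w = 0) → v = 0) : g.IsInvertible := by
  have hd : Module.finrank ℝ E = Module.finrank ℝ (E →L[ℝ] ℝ) := by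
    rw [← (LinearMap.toContinuousLinearMap : (E →ₗ[ℝ] ℝ) ≃ₗ[ℝ] (E →L[ℝ] ℝ)).finrank_eq]
    exact Subspace.dual_finrank_eq.symm
  have hi : Function.Injective g.toLinearMap := by
    rw [← LinearMap.ker_eq_bot, LinearMap.ker_eq_bot']
    exact fun v hv ↦ h v fun w ↦ congr($hv w)
  exact ⟨(LinearEquiv.ofInjectiveOfFinrankEq g.toLinearMap hi hd).toContinuousLinearEquiv, rfl⟩

variable {G : E → E →L[ℝ] E →L[ℝ] ℝ} {y : E}

/-- Both symmetries can be read off from `apply_chartCurvature`. The first Bianchi identity is not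
needed anywhere, since pair symmetry is established directly. -/
theorem IsMetricNear.isCurvatureForm (hG : IsMetricNear G y) :
    IsCurvatureForm fun a b c d ↦ G y a (chartCurvature G y d b c) := by
  have := FiniteDimensional.complete ℝ E
  have s := hG.symm.self_of_nhds
  refine ⟨by simp, by simp, fun a b c d ↦ ?_, fun a b c d ↦ ?_⟩
  · rw [hG.apply_chartCurvature, hG.apply_chartCurvature, s (christoffel G y c b),
      s (christoffel G y d b)]
    ring
  · rw [hG.apply_chartCurvature, hG.apply_chartCurvature, hG.christoffel_comm c a,
      hG.christoffel_comm d b, hG.christoffel_comm d a, hG.christoffel_comm c b,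
      s (christoffel G y a d), hG.fderiv_fderiv_comm c b, hG.fderiv_fderiv_symm b c d a,
      hG.fderiv_fderiv_comm c a, hG.fderiv_fderiv_symm a c d b,
      hG.fderiv_fderiv_comm d b, hG.fderiv_fderiv_symm b d c a,
      hG.fderiv_fderiv_comm d a, hG.fderiv_fderiv_symm a d c b]
    ring

/-- By pair symmetry the operators `c ↦ R(c, b) a` and `c ↦ R(c, a) b` are adjoint with respect to
the metric, and adjoint operators have equal trace. -/
theorem IsMetricNear.chartRicci_comm (hG : IsMetricNear G y) (a b : E) :
    chartRicci G y a b = chartRicci G y b a := by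
  have s := hG.symm.self_of_nhds
  have hR := hG.isCurvatureForm
  obtain ⟨e, he⟩ := hG.isInvertible
  set φ : E ≃ₗ[ℝ] Module.Dual ℝ E := e.toLinearEquiv.trans LinearMap.toContinuousLinearMap.symm
  have hφ (v w : E) : φ v w = G y v w := by simp [φ, ← he]
  have key : φ.conj (chartCurvature G y a b) = Module.Dual.transpose (chartCurvature G y b a) := by
    ext f w
    obtain ⟨v, rfl⟩ := φ.surjective f
    rw [LinearEquiv.conj_apply_apply, LinearEquiv.symm_apply_apply, hφ,
      Module.Dual.transpose_apply, LinearMap.comp_apply, hφ, s, hR.pair, hR.anti₁₂,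
      hR.pair, hR.anti₁₂, neg_neg, hR.pair]
  rw [chartRicci_apply, chartRicci_apply, ← LinearMap.trace_transpose', ← key,
    LinearMap.trace_conj']

/-- Traces are evaluated only for two shapes of operator: a Ricci tensor of PM form raises to a
multiple of the identity plus two rank-one maps, and constant curvature gives a multiple of the
identity minus one rank-one map. -/
theorem IsMetricNear.isCurvatureAt (hG : IsMetricNear G y) :
    IsCurvatureAt (fun a b ↦ G y a b) (fun a b c d ↦ G y a (chartCurvature G y d b c))
      (fun a b ↦ chartRicci G y a b) (chartScalarCurvature G y) where
  metric := ⟨by simp, by simp, hG.symm.self_of_nhds⟩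
  riemann := hG.isCurvatureForm
  ricci := ⟨by simp, by simp, hG.chartRicci_comm⟩
  exists_dual f := by
    obtain ⟨e, he⟩ := hG.isInvertible
    exact ⟨e.symm (LinearMap.toContinuousLinearMap f), fun a ↦ by simp [← he]⟩
  scalar_eq μ U q h := by
    obtain ⟨e, he⟩ := hG.isInvertible
    have s := hG.symm.self_of_nhds
    have key : ((ContinuousLinearMap.inverse (G y)).toLinearMap ∘ₗ
        (LinearMap.toContinuousLinearMap : (E →ₗ[ℝ] ℝ) ≃ₗ[ℝ] (E →L[ℝ] ℝ)).toLinearMap ∘ₗ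
        chartRicci G y) = μ • LinearMap.id + (1 / 2 : ℝ) • ((G y U).toLinearMap.smulRight q +
          (G y q).toLinearMap.smulRight U) := by
      ext a
      apply e.injective
      ext b
      simp [← he] at h s ⊢
      rw [h, s a b]
      ring
    rw [chartScalarCurvature, key]
    simp [LinearMap.trace_smulRight, s q U]
    ring
  ricci_eq K h a b := by
    have s := hG.symm.self_of_nhds
    obtain ⟨e, he⟩ := hG.isInvertible
    have key : chartCurvature G y b a =
        K • (G y a b • LinearMap.id - (G y a).toLinearMap.smulRight b) := by
      ext c
      apply e.injective
      ext x
      have := h x a c b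
      rw [s, s x c, s x b] at this
      simp [← he] at this ⊢
      rw [this]
      ring
    rw [chartRicci_apply, key]
    simp [LinearMap.trace_smulRight]
    ring

end Local

/-- Reduces smoothness of a product metric to smoothness of its scalar values on fixed vectors. -/
theorem contDiffAt_of_clm_apply {D E F : Type*} [NormedAddCommGroup D] [NormedSpace ℝ D]
    [NormedAddCommGroup E] [NormedSpace ℝ E] [FiniteDimensional ℝ E]
    [NormedAddCommGroup F] [NormedSpace ℝ F] {n : ℕ∞ω} {f : D → E →L[ℝ] F} {x : D}
    (h : ∀ v, ContDiffAt ℝ n (fun z ↦ f z v) x) : ContDiffAt ℝ n f x := by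
  let d := Module.finrank ℝ E
  have hd : d = Module.finrank ℝ (Fin d → ℝ) := (Module.finrank_fin_fun ℝ).symm
  let e₁ := ContinuousLinearEquiv.ofFinrankEq hd
  let e₂ := (e₁.arrowCongr (1 : F ≃L[ℝ] F)).trans (ContinuousLinearEquiv.piRing (Fin d))
  rw [← Function.id_comp f, ← e₂.symm_comp_self]
  exact e₂.symm.contDiff.contDiffAt.comp x (contDiffAt_pi.mpr fun i ↦ h _)

/-! ### Curvature of a direct sum of metrics in coordinates. -/

section LocalProduct

variable {E₁ : Type*} [NormedAddCommGroup E₁] [NormedSpace ℝ E₁]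
  {E₂ : Type*} [NormedAddCommGroup E₂] [NormedSpace ℝ E₂]

/-- The direct sum of two bilinear forms. -/
def directSumForm (g₁ : E₁ →L[ℝ] E₁ →L[ℝ] ℝ) (g₂ : E₂ →L[ℝ] E₂ →L[ℝ] ℝ) :
    E₁ × E₂ →L[ℝ] E₁ × E₂ →L[ℝ] ℝ :=
  g₁.bilinearComp (ContinuousLinearMap.fst ℝ E₁ E₂) (ContinuousLinearMap.fst ℝ E₁ E₂)
    + g₂.bilinearComp (ContinuousLinearMap.snd ℝ E₁ E₂) (ContinuousLinearMap.snd ℝ E₁ E₂)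

@[simp]
theorem directSumForm_apply (g₁ : E₁ →L[ℝ] E₁ →L[ℝ] ℝ) (g₂ : E₂ →L[ℝ] E₂ →L[ℝ] ℝ)
    (v w : E₁ × E₂) : directSumForm g₁ g₂ v w = g₁ v.1 w.1 + g₂ v.2 w.2 := by
  simp [directSumForm]

variable {G₁ : E₁ → E₁ →L[ℝ] E₁ →L[ℝ] ℝ} {G₂ : E₂ → E₂ →L[ℝ] E₂ →L[ℝ] ℝ}
  {G : E₁ × E₂ → E₁ × E₂ →L[ℝ] E₁ × E₂ →L[ℝ] ℝ} {y : E₁ × E₂}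

theorem isInvertible_directSumForm {g₁ : E₁ →L[ℝ] E₁ →L[ℝ] ℝ} {g₂ : E₂ →L[ℝ] E₂ →L[ℝ] ℝ}
    [FiniteDimensional ℝ E₁] [FiniteDimensional ℝ E₂]
    (h₁ : g₁.IsInvertible) (h₂ : g₂.IsInvertible) : (directSumForm g₁ g₂).IsInvertible := by
  obtain ⟨e₁, rfl⟩ := h₁
  obtain ⟨e₂, rfl⟩ := h₂
  refine isInvertible_of_nondegenerate fun v hv ↦ Prod.ext (e₁.injective ?_) (e₂.injective ?_)
  · ext w
    simpa using hv (w, 0)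
  · ext w
    simpa using hv (0, w)

theorem fderiv_directSum (h₁ : DifferentiableAt ℝ G₁ y.1) (h₂ : DifferentiableAt ℝ G₂ y.2)
    (hG : G =ᶠ[𝓝 y] fun z ↦ directSumForm (G₁ z.1) (G₂ z.2)) (u v w : E₁ × E₂)
    (hd : DifferentiableAt ℝ G y) :
    fderiv ℝ G y u v w = fderiv ℝ G₁ y.1 u.1 v.1 w.1 + fderiv ℝ G₂ y.2 u.2 v.2 w.2 := by
  have e1 : HasFDerivAt (fun z ↦ G z v w) _ y :=
    (hd.hasFDerivAt.clm_apply (hasFDerivAt_const v y)).clm_apply (hasFDerivAt_const w y)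
  have f₁ : HasFDerivAt (fun z : E₁ × E₂ ↦ G₁ z.1) _ y := h₁.hasFDerivAt.comp y hasFDerivAt_fst
  have f₂ : HasFDerivAt (fun z : E₁ × E₂ ↦ G₂ z.2) _ y := h₂.hasFDerivAt.comp y hasFDerivAt_snd
  have e2 : HasFDerivAt (fun z : E₁ × E₂ ↦ G₁ z.1 v.1 w.1 + G₂ z.2 v.2 w.2) _ y :=
    ((f₁.clm_apply (hasFDerivAt_const v.1 y)).clm_apply (hasFDerivAt_const w.1 y)).add
      ((f₂.clm_apply (hasFDerivAt_const v.2 y)).clm_apply (hasFDerivAt_const w.2 y))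
  have e3 := e1.unique (e2.congr_of_eventuallyEq (hG.mono fun z hz ↦ by simp [hz]))
  simpa using congr($e3 u)

variable [FiniteDimensional ℝ E₁] [FiniteDimensional ℝ E₂]

theorem IsMetricNear.directSum (h₁ : IsMetricNear G₁ y.1) (h₂ : IsMetricNear G₂ y.2)
    (hG : G =ᶠ[𝓝 y] fun z ↦ directSumForm (G₁ z.1) (G₂ z.2)) : IsMetricNear G y where
  contDiffAt := by
    refine ContDiffAt.congr_of_eventuallyEq ?_ hG
    refine contDiffAt_of_clm_apply fun v ↦ contDiffAt_of_clm_apply fun w ↦ ?_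
    simp only [directSumForm_apply]
    exact (((h₁.contDiffAt.comp y contDiffAt_fst).clm_apply contDiffAt_const).clm_apply
        contDiffAt_const).add
      (((h₂.contDiffAt.comp y contDiffAt_snd).clm_apply contDiffAt_const).clm_apply
        contDiffAt_const)
  symm := by
    filter_upwards [hG, continuousAt_fst.eventually h₁.symm, continuousAt_snd.eventually h₂.symm]
      with z hz s₁ s₂ v w
    simp [hz, s₁ v.1, s₂ v.2]
  isInvertible := by
    rw [hG.eq_of_nhds]
    exact isInvertible_directSumForm h₁.isInvertible h₂.isInvertible

/-- Both sides are tested against the metric, which avoids inverting a direct sum. The equality is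
needed on a neighbourhood because it is differentiated afterwards. -/
theorem christoffel_directSum (h₁ : IsMetricNear G₁ y.1) (h₂ : IsMetricNear G₂ y.2)
    (hG : G =ᶠ[𝓝 y] fun z ↦ directSumForm (G₁ z.1) (G₂ z.2)) :
    ∀ᶠ z in 𝓝 y, ∀ v w, christoffel G z v w =
      (christoffel G₁ z.1 v.1 w.1, christoffel G₂ z.2 v.2 w.2) := by
  have := FiniteDimensional.complete ℝ E₁
  have := FiniteDimensional.complete ℝ E₂
  have h := h₁.directSum h₂ hG
  filter_upwards [hG.eventually_nhds, h.eventually_isInvertible,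
    continuousAt_fst.eventually h₁.eventually_isInvertible,
    continuousAt_snd.eventually h₂.eventually_isInvertible,
    continuousAt_fst.eventually (h₁.contDiffAt.eventually (by simp)),
    continuousAt_snd.eventually (h₂.contDiffAt.eventually (by simp)),
    h.contDiffAt.eventually (by simp)] with z hz i i₁ i₂ c₁ c₂ c v w
  obtain ⟨e, he⟩ := id i
  apply e.injective
  refine ContinuousLinearMap.ext fun a ↦ ?_
  change (e : E₁ × E₂ →L[ℝ] E₁ × E₂ →L[ℝ] ℝ) _ a = (e : E₁ × E₂ →L[ℝ] E₁ × E₂ →L[ℝ] ℝ) _ a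
  rw [he, IsMetricNear.apply_christoffel i, EventuallyEq.eq_of_nhds hz, directSumForm_apply,
    IsMetricNear.apply_christoffel i₁, IsMetricNear.apply_christoffel i₂]
  simp only [christoffelFirst_apply]
  have hd := c.differentiableAt (by norm_num)
  have hd₁ := c₁.differentiableAt (by norm_num)
  have hd₂ := c₂.differentiableAt (by norm_num)
  rw [fderiv_directSum hd₁ hd₂ hz _ _ _ hd, fderiv_directSum hd₁ hd₂ hz _ _ _ hd,
    fderiv_directSum hd₁ hd₂ hz _ _ _ hd]
  ring

theorem chartCurvature_directSum (h₁ : IsMetricNear G₁ y.1) (h₂ : IsMetricNear G₂ y.2)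
    (hG : G =ᶠ[𝓝 y] fun z ↦ directSumForm (G₁ z.1) (G₂ z.2)) (d b : E₁ × E₂) :
    chartCurvature G y d b =
      (chartCurvature G₁ y.1 d.1 b.1).prodMap (chartCurvature G₂ y.2 d.2 b.2) := by
  have := FiniteDimensional.complete ℝ E₁
  have := FiniteDimensional.complete ℝ E₂
  have h := h₁.directSum h₂ hG
  have hΓ := christoffel_directSum h₁ h₂ hG
  have key (c d b : E₁ × E₂) : fderiv ℝ (christoffel G) y c d b =
      (fderiv ℝ (christoffel G₁) y.1 c.1 d.1 b.1, fderiv ℝ (christoffel G₂) y.2 c.2 d.2 b.2) := by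
    have e1 : HasFDerivAt (fun z ↦ christoffel G z d b) _ y :=
      (h.differentiableAt_christoffel.hasFDerivAt.clm_apply (hasFDerivAt_const d y)).clm_apply
        (hasFDerivAt_const b y)
    have f₁ : HasFDerivAt (fun z : E₁ × E₂ ↦ christoffel G₁ z.1) _ y :=
      h₁.differentiableAt_christoffel.hasFDerivAt.comp y hasFDerivAt_fst
    have f₂ : HasFDerivAt (fun z : E₁ × E₂ ↦ christoffel G₂ z.2) _ y :=
      h₂.differentiableAt_christoffel.hasFDerivAt.comp y hasFDerivAt_snd
    have e2 : HasFDerivAt (fun z : E₁ × E₂ ↦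
        (christoffel G₁ z.1 d.1 b.1, christoffel G₂ z.2 d.2 b.2)) _ y :=
      ((f₁.clm_apply (hasFDerivAt_const d.1 y)).clm_apply (hasFDerivAt_const b.1 y)).prodMk
        ((f₂.clm_apply (hasFDerivAt_const d.2 y)).clm_apply (hasFDerivAt_const b.2 y))
    have e3 := e1.unique (e2.congr_of_eventuallyEq (hΓ.mono fun z hz ↦ hz d b))
    simpa using congr($e3 c)
  refine LinearMap.ext fun c ↦ ?_
  have hy := hΓ.self_of_nhds
  simp only [chartCurvature, LinearMap.coe_mk, AddHom.coe_mk, key, hy, LinearMap.prodMap_apply]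
  rfl

theorem chartRicci_directSum (h₁ : IsMetricNear G₁ y.1) (h₂ : IsMetricNear G₂ y.2)
    (hG : G =ᶠ[𝓝 y] fun z ↦ directSumForm (G₁ z.1) (G₂ z.2)) (a b : E₁ × E₂) :
    chartRicci G y a b = chartRicci G₁ y.1 a.1 b.1 + chartRicci G₂ y.2 a.2 b.2 := by
  rw [chartRicci_apply, chartCurvature_directSum h₁ h₂ hG, LinearMap.trace_prodMap']
  rfl

theorem chartScalarCurvature_directSum (h₁ : IsMetricNear G₁ y.1) (h₂ : IsMetricNear G₂ y.2)
    (hG : G =ᶠ[𝓝 y] fun z ↦ directSumForm (G₁ z.1) (G₂ z.2)) :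
    chartScalarCurvature G y = chartScalarCurvature G₁ y.1 + chartScalarCurvature G₂ y.2 := by
  have h := h₁.directSum h₂ hG
  obtain ⟨e, he⟩ := h.isInvertible
  obtain ⟨e₁, he₁⟩ := h₁.isInvertible
  obtain ⟨e₂, he₂⟩ := h₂.isInvertible
  unfold chartScalarCurvature
  rw [← LinearMap.trace_prodMap']
  congr 1
  refine LinearMap.ext fun a ↦ ?_
  apply e.injective
  refine ContinuousLinearMap.ext fun b ↦ ?_
  have hw (w : E₁ × E₂) : e w b = e₁ w.1 b.1 + e₂ w.2 b.2 := by
    have : G y w b = G₁ y.1 w.1 b.1 + G₂ y.2 w.2 b.2 := by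
      rw [hG.eq_of_nhds, directSumForm_apply]
    simpa [← he, ← he₁, ← he₂] using this
  refine Eq.trans ?_ (hw _).symm
  simp [← he, ← he₁, ← he₂, chartRicci_directSum h₁ h₂ hG]

end LocalProduct

/-! ### From metrics on manifolds to their coordinate expressions. -/

section Chart

variable {E : Type*} [NormedAddCommGroup E] [NormedSpace ℝ E]
  {H : Type*} [TopologicalSpace H] {I : ModelWithCorners ℝ E H}
  {M : Type*} [TopologicalSpace M] [ChartedSpace H M]

theorem chartMetric_apply (g : ∀ x : M, TangentSpace I x →L[ℝ] TangentSpace I x →L[ℝ] ℝ) (x : M)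
    (y v w : E) : chartMetric g x y v w = g ((extChartAt I x).symm y)
      (mfderiv 𝓘(ℝ, E) I (extChartAt I x).symm y v)
      (mfderiv 𝓘(ℝ, E) I (extChartAt I x).symm y w) := rfl

variable [I.Boundaryless]

/-- Matches the coordinate frame with the trivialization of the tangent bundle, in terms of which
smoothness of a metric is stated. Absence of boundary turns the derivative within the range of `I`
into an ordinary one. -/
theorem mfderiv_extChartAt_symm_apply [IsManifold I 1 M] (x : M) {y : E}
    (hy : y ∈ (extChartAt I x).target) (v : E) :
    mfderiv 𝓘(ℝ, E) I (extChartAt I x).symm y v =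
      (trivializationAt E (TangentSpace I) x).symm ((extChartAt I x).symm y) v := by
  have hx : (extChartAt I x).symm y ∈ (chartAt H x).source := by
    rw [← extChartAt_source I]; exact (extChartAt I x).map_target hy
  have h := TangentBundle.symmL_trivializationAt (I := I) (𝕜 := ℝ) hx
  rw [I.range_eq_univ, mfderivWithin_univ, (extChartAt I x).right_inv hy] at h
  rw [← Bundle.Trivialization.symmL_apply (R := ℝ) _ hx]
  exact congr($h v).symm

variable [IsManifold I ∞ M]

theorem mdifferentiableAt_extChartAt_symm (x : M) {y : E} (hy : y ∈ (extChartAt I x).target) :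
    MDifferentiableAt 𝓘(ℝ, E) I (extChartAt I x).symm y := by
  have : IsManifold I 1 M := IsManifold.of_le (n := ∞) (by norm_num)
  have h := mdifferentiableWithinAt_extChartAt_symm hy
  rwa [I.range_eq_univ, mdifferentiableWithinAt_univ] at h

/-- Tangent vectors at `x` are by convention their components in the chart at `x`, so the inverse
chart has identity derivative at the base point. -/
theorem chartMetric_extChartAt
    (g : ∀ x : M, TangentSpace I x →L[ℝ] TangentSpace I x →L[ℝ] ℝ) (x : M) :
    chartMetric g x (extChartAt I x x) = g x := by
  have : IsManifold I 1 M := IsManifold.of_le (n := ∞) (by norm_num)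
  have h (v : E) : mfderiv 𝓘(ℝ, E) I (extChartAt I x).symm (extChartAt I x x) v = v := by
    rw [mfderiv_extChartAt_symm_apply x (mem_extChartAt_target x), extChartAt_to_inv,
      ← Bundle.Trivialization.symmL_apply (R := ℝ) _ (mem_chart_source H x),
      TangentBundle.symmL_trivializationAt_eq_core (mem_chart_source H x)]
    exact (tangentBundleCore I M).coordChange_self (achart H x) x (mem_achart_source H x) v
  refine ContinuousLinearMap.ext fun v ↦ ContinuousLinearMap.ext fun w ↦ ?_
  rw [chartMetric_apply, h, h, extChartAt_to_inv]
  rfl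

theorem contDiffAt_chartMetric [FiniteDimensional ℝ E]
    {g : ∀ x : M, TangentSpace I x →L[ℝ] TangentSpace I x →L[ℝ] ℝ}
    (hg : ContMDiff I (I.prod 𝓘(ℝ, E →L[ℝ] E →L[ℝ] ℝ)) ∞
      (fun x ↦ Bundle.TotalSpace.mk' (E →L[ℝ] E →L[ℝ] ℝ)
        (E := fun x ↦ TangentSpace I x →L[ℝ] TangentSpace I x →L[ℝ] ℝ) x (g x))) (x : M) :
    ContDiffAt ℝ 2 (chartMetric g x) (extChartAt I x x) := by
  have : IsManifold I 1 M := IsManifold.of_le (n := ∞) (by norm_num)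
  have ht : (extChartAt I x).target ∈ 𝓝 (extChartAt I x x) :=
    (isOpen_extChartAt_target x).mem_nhds (mem_extChartAt_target x)
  have h1 := ((contMDiffAt_hom_bundle _).1 (hg x)).2
  have h2 : ContMDiffAt 𝓘(ℝ, E) I ∞ (extChartAt I x).symm (extChartAt I x x) :=
    (contMDiffOn_extChartAt_symm x).contMDiffAt ht
  have h3 := (ContMDiffAt.comp_of_eq h1 h2 (extChartAt_to_inv x)).contDiffAt
  refine (h3.of_le (by norm_cast)).congr_of_eventuallyEq ?_
  filter_upwards [ht] with y hy
  have hx : (extChartAt I x).symm y ∈ (chartAt H x).source := by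
    rw [← extChartAt_source I]; exact (extChartAt I x).map_target hy
  have hb : (extChartAt I x).symm y ∈ (trivializationAt E (TangentSpace I) x).baseSet := hx
  refine ContinuousLinearMap.ext fun v ↦ ContinuousLinearMap.ext fun w ↦ ?_
  rw [chartMetric_apply, mfderiv_extChartAt_symm_apply x hy, mfderiv_extChartAt_symm_apply x hy]
  refine Eq.trans ?_ (inCoordinates_apply_eq₂ (E₃ := fun _ : M ↦ ℝ) (F₃ := ℝ) hb hb
    (Set.mem_univ _)).symm
  simp

theorem isMetricNear_chartMetric [FiniteDimensional ℝ E]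
    {g : ∀ x : M, TangentSpace I x →L[ℝ] TangentSpace I x →L[ℝ] ℝ}
    (hg : ContMDiff I (I.prod 𝓘(ℝ, E →L[ℝ] E →L[ℝ] ℝ)) ∞
      (fun x ↦ Bundle.TotalSpace.mk' (E →L[ℝ] E →L[ℝ] ℝ)
        (E := fun x ↦ TangentSpace I x →L[ℝ] TangentSpace I x →L[ℝ] ℝ) x (g x)))
    (hs : ∀ x v w, g x v w = g x w v) (x : M) (hn : ∀ v, (∀ w, g x v w = 0) → v = 0) :
    IsMetricNear (chartMetric g x) (extChartAt I x x) where
  contDiffAt := contDiffAt_chartMetric hg x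
  symm := .of_forall fun y v w ↦ by
    rw [chartMetric_apply, chartMetric_apply, hs]
  isInvertible := by
    rw [chartMetric_extChartAt]
    exact isInvertible_of_nondegenerate hn

theorem isCurvatureAt_of_isMetricNear [FiniteDimensional ℝ E]
    {g : ∀ x : M, TangentSpace I x →L[ℝ] TangentSpace I x →L[ℝ] ℝ} {x : M}
    (h : IsMetricNear (chartMetric g x) (extChartAt I x x)) :
    IsCurvatureAt (V := E) (fun a b ↦ g x a b) (riemann g x) (ricci g x)
      (scalarCurvature g x) := by
  have := h.isCurvatureAt
  rw [chartMetric_extChartAt] at this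
  exact this

end Chart

/-! ### Curvature of the product manifold. -/

section ChartProduct

variable {E₁ : Type*} [NormedAddCommGroup E₁] [NormedSpace ℝ E₁]
  {H₁ : Type*} [TopologicalSpace H₁] {I₁ : ModelWithCorners ℝ E₁ H₁} [I₁.Boundaryless]
  {M₁ : Type*} [TopologicalSpace M₁] [ChartedSpace H₁ M₁] [IsManifold I₁ ∞ M₁]
  {E₂ : Type*} [NormedAddCommGroup E₂] [NormedSpace ℝ E₂]
  {H₂ : Type*} [TopologicalSpace H₂] {I₂ : ModelWithCorners ℝ E₂ H₂} [I₂.Boundaryless]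
  {M₂ : Type*} [TopologicalSpace M₂] [ChartedSpace H₂ M₂] [IsManifold I₂ ∞ M₂]
  {g₁ : ∀ x : M₁, TangentSpace I₁ x →L[ℝ] TangentSpace I₁ x →L[ℝ] ℝ}
  {g₂ : ∀ x : M₂, TangentSpace I₂ x →L[ℝ] TangentSpace I₂ x →L[ℝ] ℝ} {p : M₁ × M₂}

/-- The preferred chart of the product is the product of the preferred charts, so the derivative of
its inverse is block diagonal. -/
theorem chartMetric_prodMetric
    (g₁ : ∀ x : M₁, TangentSpace I₁ x →L[ℝ] TangentSpace I₁ x →L[ℝ] ℝ)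
    (g₂ : ∀ x : M₂, TangentSpace I₂ x →L[ℝ] TangentSpace I₂ x →L[ℝ] ℝ) (p : M₁ × M₂) :
    chartMetric (prodMetric g₁ g₂) p =ᶠ[𝓝 (extChartAt (I₁.prod I₂) p p)]
      fun z ↦ directSumForm (chartMetric g₁ p.1 z.1) (chartMetric g₂ p.2 z.2) := by
  filter_upwards [(isOpen_extChartAt_target p).mem_nhds (mem_extChartAt_target p)] with z hz
  rw [extChartAt_prod] at hz
  have hd : mfderiv 𝓘(ℝ, E₁ × E₂) (I₁.prod I₂) (extChartAt (I₁.prod I₂) p).symm z =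
      (mfderiv 𝓘(ℝ, E₁) I₁ (extChartAt I₁ p.1).symm z.1).prodMap
        (mfderiv 𝓘(ℝ, E₂) I₂ (extChartAt I₂ p.2).symm z.2) := by
    have := mfderiv_prodMap (mdifferentiableAt_extChartAt_symm p.1 hz.1)
      (mdifferentiableAt_extChartAt_symm p.2 hz.2)
    rw [← this, extChartAt_prod, modelWithCornersSelf_prod, ← chartedSpaceSelf_prod]
    rfl
  refine ContinuousLinearMap.ext fun v ↦ ContinuousLinearMap.ext fun w ↦ ?_
  rw [chartMetric_apply, hd, directSumForm_apply, chartMetric_apply, chartMetric_apply,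
    extChartAt_prod]
  rfl

variable [FiniteDimensional ℝ E₁] [FiniteDimensional ℝ E₂]

theorem riemann_prodMetric (h₁ : IsMetricNear (chartMetric g₁ p.1) (extChartAt I₁ p.1 p.1))
    (h₂ : IsMetricNear (chartMetric g₂ p.2) (extChartAt I₂ p.2 p.2)) (a b c d : E₁ × E₂) :
    riemann (prodMetric g₁ g₂) p a b c d =
      riemann g₁ p.1 a.1 b.1 c.1 d.1 + riemann g₂ p.2 a.2 b.2 c.2 d.2 := by
  have hy : extChartAt (I₁.prod I₂) p p = (extChartAt I₁ p.1 p.1, extChartAt I₂ p.2 p.2) := by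
    rw [extChartAt_prod]; rfl
  have hG := chartMetric_prodMetric g₁ g₂ p
  rw [hy] at hG
  change prodMetric g₁ g₂ p a (chartCurvature (chartMetric (prodMetric g₁ g₂) p)
    (extChartAt (I₁.prod I₂) p p) d b c) = _
  rw [hy, chartCurvature_directSum (y := (_, _)) h₁ h₂ hG]
  rfl

theorem ricci_prodMetric (h₁ : IsMetricNear (chartMetric g₁ p.1) (extChartAt I₁ p.1 p.1))
    (h₂ : IsMetricNear (chartMetric g₂ p.2) (extChartAt I₂ p.2 p.2)) (a b : E₁ × E₂) :
    ricci (prodMetric g₁ g₂) p a b = ricci g₁ p.1 a.1 b.1 + ricci g₂ p.2 a.2 b.2 := by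
  have hy : extChartAt (I₁.prod I₂) p p = (extChartAt I₁ p.1 p.1, extChartAt I₂ p.2 p.2) := by
    rw [extChartAt_prod]; rfl
  have hG := chartMetric_prodMetric g₁ g₂ p
  rw [hy] at hG
  change chartRicci (chartMetric (prodMetric g₁ g₂) p) (extChartAt (I₁.prod I₂) p p) a b = _
  rw [hy, chartRicci_directSum (y := (_, _)) h₁ h₂ hG]
  rfl

theorem scalarCurvature_prodMetric
    (h₁ : IsMetricNear (chartMetric g₁ p.1) (extChartAt I₁ p.1 p.1))
    (h₂ : IsMetricNear (chartMetric g₂ p.2) (extChartAt I₂ p.2 p.2)) :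
    scalarCurvature (prodMetric g₁ g₂) p =
      scalarCurvature g₁ p.1 + scalarCurvature g₂ p.2 := by
  have hy : extChartAt (I₁.prod I₂) p p = (extChartAt I₁ p.1 p.1, extChartAt I₂ p.2 p.2) := by
    rw [extChartAt_prod]; rfl
  have hG := chartMetric_prodMetric g₁ g₂ p
  rw [hy] at hG
  rw [scalarCurvature, hy, chartScalarCurvature_directSum (y := (_, _)) h₁ h₂ hG]
  rfl

end ChartProduct

/-! ### Algebra of curvature forms, purely magnetic forms and Weyl tensors. -/

section AlgebraicCurvature

variable {V : Type*} [AddCommGroup V] [Module ℝ V]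

namespace IsSymmForm

variable {h : V → V → ℝ} (hh : IsSymmForm h)
include hh

theorem add_right (a b b' : V) : h a (b + b') = h a b + h a b' := by
  rw [hh.symm, hh.add_left, hh.symm b, hh.symm b']

theorem smul_right (r : ℝ) (a b : V) : h a (r • b) = r * h a b := by
  rw [hh.symm, hh.smul_left, hh.symm b]

theorem zero_left (b : V) : h 0 b = 0 := by
  simpa using hh.smul_left 0 0 b

theorem zero_right (b : V) : h b 0 = 0 := by
  rw [hh.symm, hh.zero_left]

end IsSymmForm

namespace IsCurvatureForm

variable {C : V → V → V → V → ℝ} (hC : IsCurvatureForm C)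
include hC

theorem anti₃₄ (a b c d : V) : C a b c d = -C a b d c := by
  rw [hC.pair, hC.anti₁₂, hC.pair]

theorem add₂ (a b b' c d : V) : C a (b + b') c d = C a b c d + C a b' c d := by
  rw [hC.anti₁₂, hC.add₁, hC.anti₁₂ a b, hC.anti₁₂ a b']
  ring

theorem smul₂ (r : ℝ) (a b c d : V) : C a (r • b) c d = r * C a b c d := by
  rw [hC.anti₁₂, hC.smul₁, hC.anti₁₂ a b]
  ring

theorem add₃ (a b c c' d : V) : C a b (c + c') d = C a b c d + C a b c' d := by
  rw [hC.pair, hC.add₁, hC.pair c, hC.pair c']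

theorem smul₃ (r : ℝ) (a b c d : V) : C a b (r • c) d = r * C a b c d := by
  rw [hC.pair, hC.smul₁, hC.pair c]

theorem add₄ (a b c d d' : V) : C a b c (d + d') = C a b c d + C a b c d' := by
  rw [hC.pair, hC.add₂, hC.pair c, hC.pair c]

theorem smul₄ (r : ℝ) (a b c d : V) : C a b c (r • d) = r * C a b c d := by
  rw [hC.pair, hC.smul₂, hC.pair c]

theorem self₁₂ (a c d : V) : C a a c d = 0 := by
  linarith [hC.anti₁₂ a a c d]

theorem self₃₄ (a b c : V) : C a b c c = 0 := by
  linarith [hC.anti₃₄ a b c c]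

theorem zero₁ (b c d : V) : C 0 b c d = 0 := by simpa using hC.smul₁ 0 0 b c d

theorem zero₂ (b c d : V) : C b 0 c d = 0 := by simpa using hC.smul₂ 0 b 0 c d

theorem zero₃ (b c d : V) : C b c 0 d = 0 := by simpa using hC.smul₃ 0 b c 0 d

theorem zero₄ (b c d : V) : C b c d 0 = 0 := by simpa using hC.smul₄ 0 b c d 0

/-- A curvature form vanishes if its components with respect to a splitting `ℝ e + W` vanish. -/
theorem eq_zero_of_split {e : V} {W : V → Prop} (hW : ∀ v, ∃ (c : ℝ) (A : V), W A ∧ v = c • e + A)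
    (h₂ : ∀ A B, W A → W B → C e A e B = 0) (h₁ : ∀ A B D, W A → W B → W D → C e A B D = 0)
    (h₀ : ∀ A B D F, W A → W B → W D → W F → C A B D F = 0) (a b c d : V) : C a b c d = 0 := by
  obtain ⟨α, A, hA, rfl⟩ := hW a
  obtain ⟨β, B, hB, rfl⟩ := hW b
  obtain ⟨γ, D, hD, rfl⟩ := hW c
  obtain ⟨δ, F, hF, rfl⟩ := hW d
  have k₁ (A B : V) (hA : W A) (hB : W B) : C e A B e = 0 := by
    rw [hC.anti₃₄, h₂ A B hA hB, neg_zero]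
  have k₂ (A B : V) (hA : W A) (hB : W B) : C A e e B = 0 := by
    rw [hC.anti₁₂, h₂ A B hA hB, neg_zero]
  have k₃ (A B : V) (hA : W A) (hB : W B) : C A e B e = 0 := by
    rw [hC.anti₁₂, k₁ A B hA hB, neg_zero]
  have k₄ (A B D : V) (hA : W A) (hB : W B) (hD : W D) : C A e B D = 0 := by
    rw [hC.anti₁₂, h₁ A B D hA hB hD, neg_zero]
  have k₅ (A B D : V) (hA : W A) (hB : W B) (hD : W D) : C A B e D = 0 := by
    rw [hC.pair, h₁ D A B hD hA hB]
  have k₆ (A B D : V) (hA : W A) (hB : W B) (hD : W D) : C A B D e = 0 := by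
    rw [hC.pair, k₄ D A B hD hA hB]
  simp only [hC.add₁, hC.add₂, hC.add₃, hC.add₄, hC.smul₁, hC.smul₂, hC.smul₃, hC.smul₄,
    hC.self₁₂, hC.self₃₄, h₂ _ _ hB hF, h₁ _ _ _ hB hD hF, k₁ _ _ hB hD,
    k₂ _ _ hA hF, k₃ _ _ hA hD, k₄ _ _ _ hA hD hF, k₅ _ _ _ hA hB hF, k₆ _ _ _ hA hB hD,
    h₀ _ _ _ _ hA hB hD hF]
  ring

end IsCurvatureForm

/-- A form is purely magnetic with respect to `u` if it is reversed by the reflection in `u`. -/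
def IsPMForm (g : V → V → ℝ) (C : V → V → V → V → ℝ) (u : V) : Prop :=
  ∀ a b c d, (C a b c d + C (a + (2 * g u a) • u) (b + (2 * g u b) • u) (c + (2 * g u c) • u)
    (d + (2 * g u d) • u)) / 2 = 0

theorem exists_split {g : V → V → ℝ} (hg : IsSymmForm g) {e : V} (he : g e e ≠ 0) (v : V) :
    ∃ (c : ℝ) (A : V), g e A = 0 ∧ v = c • e + A := by
  refine ⟨g e v / g e e, v + (-(g e v / g e e)) • e, ?_, by module⟩
  rw [hg.add_right, hg.smul_right]
  field_simp
  ring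

/-- A component with `k` arguments `u` is multiplied by `(-1)^k` under the reflection. Antisymmetry
allows `k ≤ 2`, and the two conditions are the cases `k = 2` and `k = 0`. -/
theorem isPMForm_iff {g : V → V → ℝ} {C : V → V → V → V → ℝ} (hg : IsSymmForm g)
    (hC : IsCurvatureForm C) {u : V} (hu : g u u = -1) :
    IsPMForm g C u ↔ (∀ A B, g u A = 0 → g u B = 0 → C u A u B = 0) ∧
      ∀ A B D F, g u A = 0 → g u B = 0 → g u D = 0 → g u F = 0 → C A B D F = 0 := by
  constructor
  · refine fun h ↦ ⟨fun A B hA hB ↦ ?_, fun A B D F hA hB hD hF ↦ ?_⟩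
    · have := h u A u B
      simp only [hA, hB, hu, hC.add₁, hC.add₂, hC.add₃, hC.add₄, hC.smul₁, hC.smul₂, hC.smul₃,
        hC.smul₄] at this
      linarith
    · have := h A B D F
      simp only [hA, hB, hD, hF, mul_zero, zero_smul, add_zero] at this
      linarith
  · rintro ⟨h₂, h₀⟩ a b c d
    have hne : g u u ≠ 0 := by rw [hu]; norm_num
    obtain ⟨α, A, hA, rfl⟩ := exists_split hg hne a
    obtain ⟨β, B, hB, rfl⟩ := exists_split hg hne b
    obtain ⟨γ, D, hD, rfl⟩ := exists_split hg hne c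
    obtain ⟨δ, F, hF, rfl⟩ := exists_split hg hne d
    have k₁ (A B : V) (hA : g u A = 0) (hB : g u B = 0) : C u A B u = 0 := by
      rw [hC.anti₃₄, h₂ A B hA hB, neg_zero]
    have k₂ (A B : V) (hA : g u A = 0) (hB : g u B = 0) : C A u u B = 0 := by
      rw [hC.anti₁₂, h₂ A B hA hB, neg_zero]
    have k₃ (A B : V) (hA : g u A = 0) (hB : g u B = 0) : C A u B u = 0 := by
      rw [hC.anti₁₂, k₁ A B hA hB, neg_zero]
    simp only [hg.add_right, hg.smul_right, hu, hA, hB, hD, hF]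
    simp only [hC.add₁, hC.add₂, hC.add₃, hC.add₄, hC.smul₁, hC.smul₂, hC.smul₃, hC.smul₄,
      hC.self₁₂, hC.self₃₄, h₂ _ _ hB hF, k₁ _ _ hB hD,
      k₂ _ _ hA hF, k₃ _ _ hA hD, h₀ _ _ _ _ hA hB hD hF]
    ring

/-- The Weyl tensor in dimension `n` built from a metric `g`, a Riemann tensor `R`, a Ricci tensor
`Ric` and a Ricci scalar `s`. -/
def weylForm (n : ℝ) (g : V → V → ℝ) (R : V → V → V → V → ℝ) (Ric : V → V → ℝ) (s : ℝ)
    (a b c d : V) : ℝ :=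
  R a b c d - 1 / (n - 2) * (g a c * Ric d b - g a d * Ric c b - g b c * Ric d a + g b d * Ric c a)
    + s / ((n - 1) * (n - 2)) * (g a c * g d b - g a d * g c b)

theorem isCurvatureForm_weylForm {g : V → V → ℝ} {R : V → V → V → V → ℝ} {Ric : V → V → ℝ}
    (hg : IsSymmForm g) (hR : IsCurvatureForm R) (hRic : IsSymmForm Ric) (n s : ℝ) :
    IsCurvatureForm (weylForm n g R Ric s) where
  add₁ a a' b c d := by
    simp only [weylForm, hR.add₁, hg.add_left, hRic.add_right]; ring
  smul₁ r a b c d := by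
    simp only [weylForm, hR.smul₁, hg.smul_left, hRic.smul_right]; ring
  anti₁₂ a b c d := by
    simp only [weylForm, hR.anti₁₂ a b, hg.symm d, hg.symm c]; ring
  pair a b c d := by
    simp only [weylForm, hR.pair a b, hg.symm c, hg.symm d, hRic.symm b, hRic.symm a]; ring

theorem isCurvatureForm_const {g : V → V → ℝ} (hg : IsSymmForm g) (K : ℝ) :
    IsCurvatureForm fun a b c d ↦ K * (g a c * g b d - g a d * g b c) where
  add₁ a a' b c d := by simp only [hg.add_left]; ring
  smul₁ r a b c d := by simp only [hg.smul_left]; ring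
  anti₁₂ a b c d := by ring
  pair a b c d := by simp only [hg.symm c, hg.symm d]; ring

theorem IsCurvatureForm.sub {C C' : V → V → V → V → ℝ} (hC : IsCurvatureForm C)
    (hC' : IsCurvatureForm C') : IsCurvatureForm fun a b c d ↦ C a b c d - C' a b c d where
  add₁ a a' b c d := by simp only [hC.add₁, hC'.add₁]; ring
  smul₁ r a b c d := by simp only [hC.smul₁, hC'.smul₁]; ring
  anti₁₂ a b c d := by rw [hC.anti₁₂, hC'.anti₁₂]; ring
  pair a b c d := by rw [hC.pair, hC'.pair]

/-- In dimension at most two every curvature form is a multiple of the standard one. -/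
theorem IsCurvatureForm.eq_const_of_finrank_le_two [FiniteDimensional ℝ V] {g : V → V → ℝ}
    {R : V → V → V → V → ℝ} (hR : IsCurvatureForm R) (hg : IsSymmForm g)
    (hd : ∀ f : V →ₗ[ℝ] ℝ, ∃ r, ∀ a, g r a = f a) (hV : Module.finrank ℝ V ≤ 2) {u : V}
    (hu : g u u ≠ 0) :
    ∃ K : ℝ, ∀ a b c d, R a b c d = K * (g a c * g b d - g a d * g b c) := by
  let φ : V →ₗ[ℝ] ℝ :=
    { toFun := g u, map_add' := hg.add_right u, map_smul' := fun r ↦ hg.smul_right r u }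
  have hφ : 0 < Module.finrank ℝ (LinearMap.range φ) :=
    Module.finrank_pos_iff_exists_ne_zero.2
      ⟨⟨φ u, u, rfl⟩, fun h ↦ hu congr(($h : ℝ))⟩
  have hr := φ.finrank_range_add_finrank_ker
  obtain ⟨e, he⟩ := finrank_le_one_iff.1 (show Module.finrank ℝ (LinearMap.ker φ) ≤ 1 by omega)
  have hue : g u e = 0 := e.2
  have hW (A : V) (hA : g u A = 0) : ∃ c : ℝ, A = c • (e : V) := by
    obtain ⟨c, hc⟩ := he ⟨A, hA⟩
    exact ⟨c, congr(($hc : V)).symm⟩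
  -- A null `e` is orthogonal to `u` and to itself, hence to everything; since `g` represents every
  -- functional, `e = 0`.
  have hnd (h : g e e = 0) : (e : V) = 0 := by
    refine (Module.forall_dual_apply_eq_zero_iff ℝ (e : V)).1 fun f ↦ ?_
    obtain ⟨r, hr⟩ := hd f
    obtain ⟨c, A, hA, rfl⟩ := exists_split hg hu r
    obtain ⟨c', rfl⟩ := hW A hA
    rw [← hr, hg.add_left, hg.smul_left, hg.smul_left, hue, h]
    ring
  -- If `e = 0` the quotient is `0` by convention, which is harmless because all components
  -- involving `e` vanish.
  refine ⟨R u e u e / (g u u * g e e), fun a b c d ↦ sub_eq_zero.1 ?_⟩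
  refine (hR.sub (isCurvatureForm_const hg _)).eq_zero_of_split (e := u) (W := fun A ↦ g u A = 0)
    (exists_split hg hu) (fun A B hA hB ↦ ?_) (fun A B D hA hB hD ↦ ?_)
    (fun A B D F hA hB hD hF ↦ ?_) a b c d
  · obtain ⟨α, rfl⟩ := hW A hA
    obtain ⟨β, rfl⟩ := hW B hB
    simp only [hR.smul₂, hR.smul₄, hg.smul_left, hg.smul_right, hue]
    by_cases h : g e e = 0
    · rw [hnd h, hR.zero₂, hg.zero_right]; ring
    · field_simp
      ring
  · obtain ⟨β, rfl⟩ := hW B hB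
    obtain ⟨δ, rfl⟩ := hW D hD
    simp only [hR.smul₃, hR.smul₄, hR.self₃₄, hg.smul_right, hue]
    ring
  · obtain ⟨α, rfl⟩ := hW A hA
    obtain ⟨β, rfl⟩ := hW B hB
    simp only [hR.smul₁, hR.smul₂, hR.self₁₂, hg.smul_left]
    ring

theorem mul_sub_mul_eq_zero_of_finrank_le_one [FiniteDimensional ℝ V] {g : V → V → ℝ}
    (hg : IsSymmForm g) (hV : Module.finrank ℝ V ≤ 1) (a b c d : V) :
    g a c * g b d - g a d * g b c = 0 := by
  obtain ⟨e, he⟩ := finrank_le_one_iff.1 hV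
  obtain ⟨α, rfl⟩ := he a
  obtain ⟨β, rfl⟩ := he b
  simp only [hg.smul_left]
  ring

theorem IsCurvatureAt.scalar_eq_of_forall {g : V → V → ℝ} {R : V → V → V → V → ℝ}
    {Ric : V → V → ℝ} {s : ℝ} (h : IsCurvatureAt g R Ric s) {μ : ℝ}
    (hμ : ∀ a b, Ric a b = μ * g a b) : s = Module.finrank ℝ V * μ := by
  have := h.scalar_eq μ 0 0 fun a b ↦ by simp [h.metric.zero_left, hμ]
  simpa [h.metric.zero_left] using this

end AlgebraicCurvature

/-! ### Purely magnetic Weyl tensors of direct sums, timelike vector in the first factor. -/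

section AlgebraicProduct

variable {V₁ : Type*} [AddCommGroup V₁] [Module ℝ V₁] {V₂ : Type*} [AddCommGroup V₂] [Module ℝ V₂]

/-- The direct sum of two forms. -/
def sumForm (h₁ : V₁ → V₁ → ℝ) (h₂ : V₂ → V₂ → ℝ) (a b : V₁ × V₂) : ℝ :=
  h₁ a.1 b.1 + h₂ a.2 b.2

/-- The direct sum of two quadrilinear forms. -/
def sumCurvatureForm (R₁ : V₁ → V₁ → V₁ → V₁ → ℝ) (R₂ : V₂ → V₂ → V₂ → V₂ → ℝ)
    (a b c d : V₁ × V₂) : ℝ :=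
  R₁ a.1 b.1 c.1 d.1 + R₂ a.2 b.2 c.2 d.2

/-- The mixed component `C(a, X, b, Y)` of the Weyl tensor of a direct sum of metrics. -/
def mixedForm (n : ℝ) (g₁ Ric₁ : V₁ → V₁ → ℝ) (g₂ Ric₂ : V₂ → V₂ → ℝ) (s : ℝ)
    (a b : V₁) (X Y : V₂) : ℝ :=
  -(1 / (n - 2)) * (g₁ a b * Ric₂ X Y + g₂ X Y * Ric₁ a b)
    + s / ((n - 1) * (n - 2)) * (g₁ a b * g₂ X Y)

variable {g₁ Ric₁ : V₁ → V₁ → ℝ} {R₁ : V₁ → V₁ → V₁ → V₁ → ℝ} {s₁ : ℝ}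
  {g₂ Ric₂ : V₂ → V₂ → ℝ} {R₂ : V₂ → V₂ → V₂ → V₂ → ℝ} {s₂ : ℝ}

theorem IsSymmForm.sumForm {h₁ : V₁ → V₁ → ℝ} {h₂ : V₂ → V₂ → ℝ} (H₁ : IsSymmForm h₁)
    (H₂ : IsSymmForm h₂) : IsSymmForm (sumForm h₁ h₂) where
  add_left a a' b := by
    simp only [PMProduct.sumForm, Prod.fst_add, Prod.snd_add, H₁.add_left, H₂.add_left]; ring
  smul_left r a b := by
    simp only [PMProduct.sumForm, Prod.smul_fst, Prod.smul_snd, H₁.smul_left, H₂.smul_left]; ring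
  symm a b := by
    rw [PMProduct.sumForm, PMProduct.sumForm, H₁.symm, H₂.symm]

theorem IsCurvatureForm.sumCurvatureForm (H₁ : IsCurvatureForm R₁) (H₂ : IsCurvatureForm R₂) :
    IsCurvatureForm (sumCurvatureForm R₁ R₂) where
  add₁ a a' b c d := by
    simp only [PMProduct.sumCurvatureForm, Prod.fst_add, Prod.snd_add, H₁.add₁, H₂.add₁]; ring
  smul₁ r a b c d := by
    simp only [PMProduct.sumCurvatureForm, Prod.smul_fst, Prod.smul_snd, H₁.smul₁, H₂.smul₁]; ring
  anti₁₂ a b c d := by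
    simp only [PMProduct.sumCurvatureForm]; rw [H₁.anti₁₂, H₂.anti₁₂]; ring
  pair a b c d := by
    simp only [PMProduct.sumCurvatureForm]; rw [H₁.pair, H₂.pair]

/-- The Weyl tensor of a direct sum of metrics. -/
abbrev prodWeyl (n : ℝ) (g₁ : V₁ → V₁ → ℝ) (R₁ : V₁ → V₁ → V₁ → V₁ → ℝ) (Ric₁ : V₁ → V₁ → ℝ)
    (g₂ : V₂ → V₂ → ℝ) (R₂ : V₂ → V₂ → V₂ → V₂ → ℝ) (Ric₂ : V₂ → V₂ → ℝ) (s : ℝ) :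
    V₁ × V₂ → V₁ × V₂ → V₁ × V₂ → V₁ × V₂ → ℝ :=
  weylForm n (sumForm g₁ g₂) (sumCurvatureForm R₁ R₂) (sumForm Ric₁ Ric₂) s

/-- The diagonal blocks carry the dimension and Ricci scalar of the whole space, so they are not the
Weyl tensors of the factors. They are still curvature forms, because `isCurvatureForm_weylForm`
allows arbitrary `n` and `s`. -/
theorem prodWeyl_eq (hg₁ : IsSymmForm g₁) (hR₁ : IsSymmForm Ric₁) (hg₂ : IsSymmForm g₂)
    (hR₂ : IsSymmForm Ric₂) (n s : ℝ) (a b c d : V₁) (X Y Z W : V₂) :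
    prodWeyl n g₁ R₁ Ric₁ g₂ R₂ Ric₂ s (a, X) (b, Y) (c, Z) (d, W) =
      weylForm n g₁ R₁ Ric₁ s a b c d + weylForm n g₂ R₂ Ric₂ s X Y Z W
      + (mixedForm n g₁ Ric₁ g₂ Ric₂ s a c Y W - mixedForm n g₁ Ric₁ g₂ Ric₂ s a d Y Z
        - mixedForm n g₁ Ric₁ g₂ Ric₂ s b c X W + mixedForm n g₁ Ric₁ g₂ Ric₂ s b d X Z) := by
  simp only [weylForm, sumForm, sumCurvatureForm, mixedForm, hg₁.symm d, hg₁.symm c,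
    hR₁.symm d, hR₁.symm c, hg₂.symm W, hg₂.symm Z, hR₂.symm W, hR₂.symm Z]
  ring

/-- The conditions on the two factors, at a point, which characterize that the Weyl tensor of the
direct sum is purely magnetic with respect to a vector `U` of the first factor. -/
def PMFactors (n₁ n₂ : ℝ) (g₁ : V₁ → V₁ → ℝ) (R₁ : V₁ → V₁ → V₁ → V₁ → ℝ) (Ric₁ : V₁ → V₁ → ℝ)
    (s₁ : ℝ) (g₂ : V₂ → V₂ → ℝ) (R₂ : V₂ → V₂ → V₂ → V₂ → ℝ) (Ric₂ : V₂ → V₂ → ℝ) (s₂ : ℝ)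
    (U : V₁) (κ : ℝ) : Prop :=
  (∃ q, g₁ U q = 0 ∧ ∀ a b,
    Ric₁ a b = (n₁ - 1) * κ * g₁ a b + 1 / 2 * (g₁ U a * g₁ q b + g₁ U b * g₁ q a)) ∧
  s₁ = n₁ * (n₁ - 1) * κ ∧
  (∀ X Y, Ric₂ X Y = -((n₂ - 1) * κ) * g₂ X Y) ∧ s₂ = -(n₂ * (n₂ - 1) * κ) ∧
  (∀ X Y Z W, R₂ X Y Z W = -κ * (g₂ X Z * g₂ Y W - g₂ X W * g₂ Y Z)) ∧
  (∀ A B, g₁ U A = 0 → g₁ U B = 0 →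
    R₁ U A U B = κ * (g₁ U U * g₁ A B - g₁ U B * g₁ A U)) ∧
  ∀ A B D F, g₁ U A = 0 → g₁ U B = 0 → g₁ U D = 0 → g₁ U F = 0 →
    R₁ A B D F = κ * (g₁ A D * g₁ B F - g₁ A F * g₁ B D)

variable {U : V₁}

/-- The even components see only curvatures `κ` and `-κ`, whose contributions to the Weyl tensor
cancel. The covector `q` enters only components in which `U` occurs once. -/
theorem PMFactors.isPMForm {n₁ n₂ κ : ℝ} (h : 4 ≤ n₁ + n₂)
    (H₁ : IsCurvatureAt g₁ R₁ Ric₁ s₁) (H₂ : IsCurvatureAt g₂ R₂ Ric₂ s₂) (hU : g₁ U U = -1)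
    (hF : PMFactors n₁ n₂ g₁ R₁ Ric₁ s₁ g₂ R₂ Ric₂ s₂ U κ) :
    IsPMForm (sumForm g₁ g₂) (prodWeyl (n₁ + n₂) g₁ R₁ Ric₁ g₂ R₂ Ric₂ (s₁ + s₂)) (U, 0) := by
  obtain ⟨⟨q, hq, hRic₁⟩, rfl, hRic₂, rfl, hR₂, hR₁, hR₁'⟩ := hF
  have e1 : n₁ + n₂ - 2 ≠ 0 := by linarith
  have e2 : n₁ + n₂ - 1 ≠ 0 := by linarith
  have hg := H₁.metric.sumForm H₂.metric
  rw [isPMForm_iff hg (isCurvatureForm_weylForm hg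
    (H₁.riemann.sumCurvatureForm H₂.riemann) (H₁.ricci.sumForm H₂.ricci) _ _)
    (by simp [sumForm, hU, H₂.metric.zero_left])]
  have hq' : g₁ q U = 0 := by rw [H₁.metric.symm, hq]
  constructor
  · rintro ⟨A, X⟩ ⟨B, Y⟩ hA hB
    simp only [sumForm, H₂.metric.zero_left, add_zero] at hA hB
    have hA' : g₁ A U = 0 := by rw [H₁.metric.symm, hA]
    have hB' : g₁ B U = 0 := by rw [H₁.metric.symm, hB]
    simp only [weylForm, sumForm, sumCurvatureForm, hR₁ A B hA hB, hRic₁, hRic₂, hR₂, hA, hB, hU,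
      hA', hB', H₂.metric.zero_left, H₂.metric.zero_right, hq', H₁.metric.symm B A,
      H₂.metric.symm Y X]
    field_simp
    ring
  · rintro ⟨A, X⟩ ⟨B, Y⟩ ⟨D, Z⟩ ⟨F, W⟩ hA hB hD hF
    simp only [sumForm, H₂.metric.zero_left, add_zero] at hA hB hD hF
    simp only [weylForm, sumForm, sumCurvatureForm, hR₁' A B D F hA hB hD hF, hRic₁, hRic₂, hR₂,
      hA, hB, hD, hF, H₁.metric.symm F, H₁.metric.symm D, H₂.metric.symm W, H₂.metric.symm Z]
    field_simp
    ring

theorem IsCurvatureAt.exists_ricci_eq (H : IsCurvatureAt g₁ R₁ Ric₁ s₁) (hU : g₁ U U = -1)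
    {μ : ℝ} (hμ : Ric₁ U U = -μ)
    (h : ∀ A B, g₁ U A = 0 → g₁ U B = 0 → Ric₁ A B = μ * g₁ A B) :
    ∃ q, g₁ U q = 0 ∧
      ∀ a b, Ric₁ a b = μ * g₁ a b + 1 / 2 * (g₁ U a * g₁ q b + g₁ U b * g₁ q a) := by
  have m := H.metric
  have ρ := H.ricci
  obtain ⟨r, hr⟩ := H.exists_dual
    { toFun := Ric₁ U, map_add' := ρ.add_right U, map_smul' := fun c ↦ ρ.smul_right c U }
  simp only [LinearMap.coe_mk, AddHom.coe_mk] at hr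
  have hrU : g₁ U r = -μ := by rw [m.symm, hr, hμ]
  -- The factor `-2` offsets `1 / 2` and `g₁ U U = -1`; the multiple of `U` makes `q` orthogonal to
  -- `U`.
  refine ⟨(-2 : ℝ) • r + (2 * μ) • U, ?_, fun a b ↦ ?_⟩
  · rw [m.add_right, m.smul_right, m.smul_right, hrU, hU]
    ring
  · have hne : g₁ U U ≠ 0 := by rw [hU]; norm_num
    obtain ⟨α, A, hA, rfl⟩ := exists_split m hne a
    obtain ⟨β, B, hB, rfl⟩ := exists_split m hne b
    simp only [m.add_right, m.smul_right, m.add_left, m.smul_left, ρ.add_right, ρ.smul_right,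
      ρ.add_left, ρ.smul_left, hU, hA, hB, hr, m.symm A U, h A B hA hB, hμ, ρ.symm A U]
    ring

/-- The components `C(U,X,U,Y)` make `Ric₂` proportional to `g₂`, and then `C(A,X,B,X)` with `X ≠ 0`
fixes `Ric₁` on the complement of `U`. Traces tie both factors to one `κ`; the remaining even
components then give `R₂` and the even part of `R₁`. -/
theorem exists_pmFactors_of_isPMForm [FiniteDimensional ℝ V₁] [FiniteDimensional ℝ V₂]
    (h₁ : 2 ≤ Module.finrank ℝ V₁)
    (h₂ : 1 ≤ Module.finrank ℝ V₂) (h : 4 ≤ Module.finrank ℝ V₁ + Module.finrank ℝ V₂)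
    (H₁ : IsCurvatureAt g₁ R₁ Ric₁ s₁) (H₂ : IsCurvatureAt g₂ R₂ Ric₂ s₂) (hU : g₁ U U = -1)
    (hpos : ∀ X, X ≠ 0 → 0 < g₂ X X)
    (hP : IsPMForm (sumForm g₁ g₂) (prodWeyl (Module.finrank ℝ V₁ + Module.finrank ℝ V₂)
      g₁ R₁ Ric₁ g₂ R₂ Ric₂ (s₁ + s₂)) (U, 0)) :
    ∃ κ, PMFactors (Module.finrank ℝ V₁) (Module.finrank ℝ V₂) g₁ R₁ Ric₁ s₁ g₂ R₂ Ric₂ s₂ U κ := by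
  have hg := H₁.metric.sumForm H₂.metric
  rw [isPMForm_iff hg (isCurvatureForm_weylForm hg
    (H₁.riemann.sumCurvatureForm H₂.riemann) (H₁.ricci.sumForm H₂.ricci) _ _)
    (by simp [sumForm, hU, H₂.metric.zero_left])] at hP
  have h₁' : (2 : ℝ) ≤ Module.finrank ℝ V₁ := by exact_mod_cast h₁
  have h' : (4 : ℝ) ≤ Module.finrank ℝ V₁ + Module.finrank ℝ V₂ := by exact_mod_cast h
  have hs₁ := H₁.scalar_eq
  have hs₂ := @H₂.scalar_eq_of_forall
  set n₁ := (Module.finrank ℝ V₁ : ℝ)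
  set n₂ := (Module.finrank ℝ V₂ : ℝ)
  have e1 : n₁ + n₂ - 2 ≠ 0 := by linarith
  have e2 : n₁ + n₂ - 1 ≠ 0 := by linarith
  have e3 : n₁ - 1 ≠ 0 := by linarith
  obtain ⟨hE, hO⟩ := hP
  have z₁ := H₁.riemann
  have z₂ := H₂.riemann
  have m₁ := H₁.metric
  have m₂ := H₂.metric
  have r₁ := H₁.ricci
  have r₂ := H₂.ricci
  -- the mixed components determine the Ricci tensors
  have hRic₂ (X Y : V₂) : Ric₂ X Y =
      (Ric₁ U U + (s₁ + s₂) / (n₁ + n₂ - 1)) * g₂ X Y := by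
    have := hE (0, X) (0, Y) (by simp [sumForm, m₁.zero_right, m₂.zero_left])
      (by simp [sumForm, m₁.zero_right, m₂.zero_left])
    simp only [weylForm, sumForm, sumCurvatureForm, hU, z₁.zero₂, z₂.zero₁, m₁.zero_left,
      m₁.zero_right, m₂.zero_left, m₂.zero_right, r₁.zero_left, r₁.zero_right, r₂.zero_left,
      r₂.zero_right, m₂.symm Y X, r₂.symm Y X] at this
    field_simp at this ⊢
    linarith
  obtain ⟨X₀, hX₀⟩ : ∃ X : V₂, X ≠ 0 := by
    have := Module.finrank_pos_iff_exists_ne_zero (R := ℝ) (M := V₂)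
    exact this.1 (by omega)
  have hX := (hpos X₀ hX₀).ne'
  have hRic₁ (A B : V₁) (hA : g₁ U A = 0) (hB : g₁ U B = 0) : Ric₁ A B = -Ric₁ U U * g₁ A B := by
    have := hO (A, 0) (0, X₀) (B, 0) (0, X₀)
    simp only [weylForm, sumForm, sumCurvatureForm, hA, hB, z₁.zero₂, z₂.zero₁, m₁.zero_left,
      m₁.zero_right, m₂.zero_left, m₂.zero_right, r₁.zero_left, r₁.zero_right, r₂.zero_left,
      r₂.zero_right, hRic₂, r₁.symm B A, add_zero, forall_const] at this
    field_simp at this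
    apply mul_right_cancel₀ hX
    apply mul_left_cancel₀ e2
    linear_combination -this
  obtain ⟨q, hq, hRic⟩ := H₁.exists_ricci_eq hU (neg_neg _).symm hRic₁
  have hs₁ := hs₁ _ _ _ hRic
  have hs₂ := hs₂ hRic₂
  rw [hq, add_zero] at hs₁
  change s₁ = n₁ * _ at hs₁
  change s₂ = n₂ * _ at hs₂
  obtain ⟨κ, hκ⟩ : ∃ κ, Ric₁ U U = -((n₁ - 1) * κ) :=
    ⟨-Ric₁ U U / (n₁ - 1), by field_simp⟩
  -- The factor `l` with `Ric₂ = l g₂` also occurs in `s₂ = n₂ * l`. Clearing denominators leaves a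
  -- linear equation for `l` with leading coefficient `n₁ - 1`, nonzero since `n₁ ≥ 2`.
  have hlam : Ric₁ U U + (s₁ + s₂) / (n₁ + n₂ - 1) = -((n₂ - 1) * κ) := by
    set l := Ric₁ U U + (s₁ + s₂) / (n₁ + n₂ - 1) with hl
    have hl' : (l - Ric₁ U U) * (n₁ + n₂ - 1) = s₁ + s₂ := by
      rw [hl]; field_simp; ring
    rw [hs₁, hs₂, hκ] at hl'
    apply mul_left_cancel₀ e3
    linarith
  rw [hlam] at hs₂
  simp only [hlam] at hRic₂
  rw [hκ, neg_neg] at hs₁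
  simp only [hκ, neg_neg] at hRic
  have hs₁ : s₁ = n₁ * (n₁ - 1) * κ := by rw [hs₁]; ring
  have hs₂ : s₂ = -(n₂ * (n₂ - 1) * κ) := by rw [hs₂]; ring
  refine ⟨κ, ⟨q, hq, hRic⟩, hs₁, hRic₂, hs₂, fun X Y Z W ↦ ?_, fun A B hA hB ↦ ?_,
    fun A B D F hA hB hD hF ↦ ?_⟩
  · have := hO (0, X) (0, Y) (0, Z) (0, W)
    simp only [weylForm, sumForm, sumCurvatureForm, m₁.zero_left, m₁.zero_right, m₂.zero_left,
      r₁.zero_left, z₁.zero₁, hRic₂, hs₁, hs₂, m₂.symm W, m₂.symm Z, add_zero, zero_add,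
      forall_const] at this
    field_simp at this
    apply mul_left_cancel₀ (mul_ne_zero e1 e2)
    linear_combination this
  · have := hE (A, 0) (B, 0) (by simp [sumForm, hA, m₂.zero_left])
      (by simp [sumForm, hB, m₂.zero_left])
    have hA' : g₁ A U = 0 := by rw [m₁.symm, hA]
    have hB' : g₁ B U = 0 := by rw [m₁.symm, hB]
    have hq' : g₁ q U = 0 := by rw [m₁.symm, hq]
    simp only [weylForm, sumForm, sumCurvatureForm, m₂.zero_left,
      r₂.zero_left, z₂.zero₁, hRic, hs₁, hs₂, hA, hB, hA', hB', hU, hq', m₁.symm B A, add_zero]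
      at this
    rw [hU, hB]
    field_simp at this
    apply mul_left_cancel₀ (mul_ne_zero e1 e2)
    linear_combination 1 / 2 * this
  · have := hO (A, 0) (B, 0) (D, 0) (F, 0)
    simp only [weylForm, sumForm, sumCurvatureForm, m₂.zero_left, r₂.zero_left, z₂.zero₁, hRic,
      hs₁, hs₂, hA, hB, hD, hF, m₁.symm F, m₁.symm D, add_zero, forall_const] at this
    field_simp at this
    apply mul_left_cancel₀ (mul_ne_zero e1 e2)
    linear_combination 1 / 2 * this

end AlgebraicProduct

/-! ### Converse for the factors, vanishing results for (2), and magnetic components. -/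

section AlgebraicProduct

variable {V₁ : Type*} [AddCommGroup V₁] [Module ℝ V₁] {V₂ : Type*} [AddCommGroup V₂] [Module ℝ V₂]
  {g₁ Ric₁ : V₁ → V₁ → ℝ} {R₁ : V₁ → V₁ → V₁ → V₁ → ℝ} {s₁ : ℝ}
  {g₂ Ric₂ : V₂ → V₂ → ℝ} {R₂ : V₂ → V₂ → V₂ → V₂ → ℝ} {s₂ : ℝ} {U : V₁}

/-- The even components of `R₁` and `Ric₁` are those of constant curvature `κ`, which has no Weyl
tensor. -/
theorem PMFactors.isPMForm_fst {W : Type*} {g₂ Ric₂ : W → W → ℝ}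
    {R₂ : W → W → W → W → ℝ} {n₁ n₂ κ : ℝ} (h₁ : 3 ≤ n₁)
    (H₁ : IsCurvatureAt g₁ R₁ Ric₁ s₁) (hU : g₁ U U = -1)
    (hF : PMFactors n₁ n₂ g₁ R₁ Ric₁ s₁ g₂ R₂ Ric₂ s₂ U κ) :
    IsPMForm g₁ (weylForm n₁ g₁ R₁ Ric₁ s₁) U := by
  obtain ⟨⟨q, hq, hRic₁⟩, rfl, -, -, -, hR₁, hR₁'⟩ := hF
  have e1 : n₁ - 2 ≠ 0 := by linarith
  have e2 : n₁ - 1 ≠ 0 := by linarith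
  have m := H₁.metric
  rw [isPMForm_iff m (isCurvatureForm_weylForm m H₁.riemann H₁.ricci _ _) hU]
  refine ⟨fun A B hA hB ↦ ?_, fun A B D F hA hB hD hF ↦ ?_⟩
  · have hA' : g₁ A U = 0 := by rw [m.symm, hA]
    have hB' : g₁ B U = 0 := by rw [m.symm, hB]
    have hq' : g₁ q U = 0 := by rw [m.symm, hq]
    simp only [weylForm, hR₁ A B hA hB, hRic₁, hA, hB, hU, hA', hB', hq', m.symm B A]
    field_simp
    ring
  · simp only [weylForm, hR₁' A B D F hA hB hD hF, hRic₁, hA, hB, hD, hF, m.symm F, m.symm D]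
    field_simp
    ring

/-- Here `κ` is read off from `s₁`, and (c) links it to `K`. A PM Weyl tensor together with the
Ricci form determines the even part of `R₁` when `n₁ ≥ 3`; for `n₁ = 2` the curvature is
automatically of constant type. -/
theorem exists_pmFactors [FiniteDimensional ℝ V₁] [FiniteDimensional ℝ V₂]
    (h₁ : 2 ≤ Module.finrank ℝ V₁) (h₂ : 1 ≤ Module.finrank ℝ V₂)
    (H₁ : IsCurvatureAt g₁ R₁ Ric₁ s₁) (H₂ : IsCurvatureAt g₂ R₂ Ric₂ s₂) (hU : g₁ U U = -1)
    (hC : 3 ≤ Module.finrank ℝ V₁ →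
      IsPMForm g₁ (weylForm (Module.finrank ℝ V₁) g₁ R₁ Ric₁ s₁) U)
    (hRic : ∃ q, g₁ U q = 0 ∧ ∀ a b, Ric₁ a b = s₁ / (Module.finrank ℝ V₁) * g₁ a b
      + 1 / 2 * (g₁ U a * g₁ q b + g₁ U b * g₁ q a))
    {K : ℝ} (hK : ∀ X Y Z W, R₂ X Y Z W = K * (g₂ X Z * g₂ Y W - g₂ X W * g₂ Y Z))
    (hs : (Module.finrank ℝ V₂ : ℝ) * (Module.finrank ℝ V₂ - 1) * s₁
      + (Module.finrank ℝ V₁ : ℝ) * (Module.finrank ℝ V₁ - 1) * s₂ = 0) :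
    ∃ κ, PMFactors (Module.finrank ℝ V₁) (Module.finrank ℝ V₂) g₁ R₁ Ric₁ s₁ g₂ R₂ Ric₂ s₂ U κ := by
  have hRic₂ := H₂.ricci_eq K hK
  have hs₂ := H₂.scalar_eq_of_forall hRic₂
  have h₁' : (2 : ℝ) ≤ Module.finrank ℝ V₁ := by exact_mod_cast h₁
  have h₂' : (1 : ℝ) ≤ Module.finrank ℝ V₂ := by exact_mod_cast h₂
  have e3 : (Module.finrank ℝ V₁ : ℝ) - 1 ≠ 0 := by linarith
  have e4 : (Module.finrank ℝ V₁ : ℝ) ≠ 0 := by linarith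
  have e5 : (Module.finrank ℝ V₂ : ℝ) ≠ 0 := by linarith
  obtain ⟨κ, hκ⟩ : ∃ κ, s₁ = Module.finrank ℝ V₁ * (Module.finrank ℝ V₁ - 1) * κ :=
    ⟨s₁ / (Module.finrank ℝ V₁ * (Module.finrank ℝ V₁ - 1)), by field_simp⟩
  have hdiv : s₁ / (Module.finrank ℝ V₁) = (Module.finrank ℝ V₁ - 1) * κ := by
    rw [hκ]; field_simp
  rw [hdiv] at hRic
  obtain ⟨q, hq, hRic⟩ := hRic
  -- The factor `n₂ - 1` must stay: for `n₂ = 1` the constant `K` is arbitrary, and the form it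
  -- multiplies is zero.
  have hKκ : (Module.finrank ℝ V₂ - 1) * K = -((Module.finrank ℝ V₂ - 1) * κ) := by
    rw [hκ, hs₂] at hs
    apply mul_left_cancel₀ (mul_ne_zero (mul_ne_zero e3 e4) e5)
    linear_combination hs
  have m := H₁.metric
  have hR₁ : (∀ A B, g₁ U A = 0 → g₁ U B = 0 →
      R₁ U A U B = κ * (g₁ U U * g₁ A B - g₁ U B * g₁ A U)) ∧
      ∀ A B D F, g₁ U A = 0 → g₁ U B = 0 → g₁ U D = 0 → g₁ U F = 0 →
        R₁ A B D F = κ * (g₁ A D * g₁ B F - g₁ A F * g₁ B D) := by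
    rcases h₁.lt_or_eq with h3 | h3
    · have e6 : (Module.finrank ℝ V₁ : ℝ) - 2 ≠ 0 := by
        have : (3 : ℝ) ≤ Module.finrank ℝ V₁ := by exact_mod_cast h3
        linarith
      obtain ⟨hE, hO⟩ := (isPMForm_iff m
        (isCurvatureForm_weylForm m H₁.riemann H₁.ricci _ _) hU).1 (hC h3)
      refine ⟨fun A B hA hB ↦ ?_, fun A B D F hA hB hD hF ↦ ?_⟩
      · have := hE A B hA hB
        have hA' : g₁ A U = 0 := by rw [m.symm, hA]
        have hB' : g₁ B U = 0 := by rw [m.symm, hB]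
        have hq' : g₁ q U = 0 := by rw [m.symm, hq]
        simp only [weylForm, hRic, hA, hB, hU, hA', hB', hq', m.symm B A, hκ] at this
        rw [hU, hB]
        field_simp at this
        apply mul_left_cancel₀ e6
        linear_combination 1 / 2 * this
      · have := hO A B D F hA hB hD hF
        simp only [weylForm, hRic, hA, hB, hD, hF, m.symm F, m.symm D, hκ] at this
        field_simp at this
        apply mul_left_cancel₀ e6
        linear_combination 1 / 2 * this
    · obtain ⟨K', hK'⟩ := H₁.riemann.eq_const_of_finrank_le_two m H₁.exists_dual h3.ge
        (u := U) (by rw [hU]; norm_num)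
      have : s₁ = _ := H₁.scalar_eq_of_forall (H₁.ricci_eq K' hK')
      rw [hκ, ← h3] at this
      have hKK : K' = κ := by push_cast at this; linarith
      subst hKK
      exact ⟨fun A B _ _ ↦ hK' _ _ _ _, fun A B D F _ _ _ _ ↦ hK' _ _ _ _⟩
  refine ⟨κ, ⟨q, hq, hRic⟩, hκ, fun X Y ↦ ?_, ?_, fun X Y Z W ↦ ?_, hR₁.1, hR₁.2⟩
  · rw [hRic₂]
    linear_combination hKκ * g₂ X Y
  · rw [hs₂]
    linear_combination hKκ * Module.finrank ℝ V₂
  · rw [hK]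
    rcases h₂.lt_or_eq with h3 | h3
    · have e6 : (Module.finrank ℝ V₂ : ℝ) - 1 ≠ 0 := by
        have : (2 : ℝ) ≤ Module.finrank ℝ V₂ := by exact_mod_cast h3
        linarith
      rw [show K = -κ from mul_left_cancel₀ e6 (by linear_combination hKκ)]
    · rw [mul_sub_mul_eq_zero_of_finrank_le_one H₂.metric h3.ge, mul_zero, mul_zero]

theorem isSymmForm_mixedForm_left {W : Type*} {g₂ Ric₂ : W → W → ℝ}
    (hg₁ : IsSymmForm g₁) (hR₁ : IsSymmForm Ric₁) (n s : ℝ) (X Y : W) :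
    IsSymmForm fun a b ↦ mixedForm n g₁ Ric₁ g₂ Ric₂ s a b X Y where
  add_left a a' b := by simp only [mixedForm, hg₁.add_left, hR₁.add_left]; ring
  smul_left r a b := by simp only [mixedForm, hg₁.smul_left, hR₁.smul_left]; ring
  symm a b := by rw [mixedForm, mixedForm, hg₁.symm, hR₁.symm]

theorem isSymmForm_mixedForm_right {W : Type*} {g₁ Ric₁ : W → W → ℝ}
    (hg₂ : IsSymmForm g₂) (hR₂ : IsSymmForm Ric₂) (n s : ℝ) (a b : W) :
    IsSymmForm fun X Y ↦ mixedForm n g₁ Ric₁ g₂ Ric₂ s a b X Y where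
  add_left X X' Y := by simp only [mixedForm, hg₂.add_left, hR₂.add_left]; ring
  smul_left r X Y := by simp only [mixedForm, hg₂.smul_left, hR₂.smul_left]; ring
  symm X Y := by rw [mixedForm, mixedForm, hg₂.symm, hR₂.symm]

theorem IsSymmForm.eq_zero_of_split {V : Type*} [AddCommGroup V] [Module ℝ V] {h : V → V → ℝ}
    (hh : IsSymmForm h) {e : V} {W : V → Prop}
    (hW : ∀ v, ∃ (c : ℝ) (A : V), W A ∧ v = c • e + A) (h₂ : h e e = 0)
    (h₁ : ∀ A, W A → h e A = 0) (h₀ : ∀ A B, W A → W B → h A B = 0) (a b : V) : h a b = 0 := by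
  obtain ⟨α, A, hA, rfl⟩ := hW a
  obtain ⟨β, B, hB, rfl⟩ := hW b
  simp only [hh.add_left, hh.add_right, hh.smul_left, hh.smul_right, h₂, h₁ B hB, hh.symm A e,
    h₁ A hA, h₀ A B hA hB]
  ring

/-- The Weyl tensor of a direct sum can be purely magnetic with respect to a unit timelike vector
which does not live in the first factor only if it vanishes. -/
theorem prodWeyl_eq_zero_of_snd_ne_zero (H₁ : IsCurvatureAt g₁ R₁ Ric₁ s₁)
    (H₂ : IsCurvatureAt g₂ R₂ Ric₂ s₂) (hpos : ∀ X, X ≠ 0 → 0 < g₂ X X) {n s : ℝ} {u : V₁ × V₂}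
    (hu : sumForm g₁ g₂ u u = -1) (hu₂ : u.2 ≠ 0)
    (hP : IsPMForm (sumForm g₁ g₂) (prodWeyl n g₁ R₁ Ric₁ g₂ R₂ Ric₂ s) u) (a b c d : V₁ × V₂) :
    prodWeyl n g₁ R₁ Ric₁ g₂ R₂ Ric₂ s a b c d = 0 := by
  have hg := H₁.metric.sumForm H₂.metric
  rw [isPMForm_iff hg (isCurvatureForm_weylForm hg
    (H₁.riemann.sumCurvatureForm H₂.riemann) (H₁.ricci.sumForm H₂.ricci) _ _) hu] at hP
  obtain ⟨hE, hO⟩ := hP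
  obtain ⟨u₁, u₂⟩ := u
  have m₁ := H₁.metric
  have m₂ := H₂.metric
  have hexp := prodWeyl_eq (R₁ := R₁) (R₂ := R₂) m₁ H₁.ricci m₂ H₂.ricci n s
  have hP := isCurvatureForm_weylForm m₁ H₁.riemann H₁.ricci n s
  have hQ := isCurvatureForm_weylForm m₂ H₂.riemann H₂.ricci n s
  have hS := fun X Y ↦ isSymmForm_mixedForm_left (g₂ := g₂) (Ric₂ := Ric₂) m₁ H₁.ricci n s X Y
  have hT := fun a b ↦ isSymmForm_mixedForm_right (g₁ := g₁) (Ric₁ := Ric₁) m₂ H₂.ricci n s a b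
  set P := weylForm n g₁ R₁ Ric₁ s
  set Q := weylForm n g₂ R₂ Ric₂ s
  set S := mixedForm n g₁ Ric₁ g₂ Ric₂ s
  -- With `α = g₂ u₂ u₂ > 0` the normalization gives `g₁ u₁ u₁ = -(1 + α)`, so both parts of `u` are
  -- non-null and split their factors.
  obtain ⟨α, hα⟩ : ∃ α, α = g₂ u₂ u₂ := ⟨_, rfl⟩
  have hα0 : 0 < α := hα ▸ hpos u₂ hu₂
  have hβ : g₁ u₁ u₁ = -(1 + α) := by
    simp only [sumForm] at hu
    linarith
  simp only [hexp] at hE hO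
  have sMl (X Y : V₂) (r : ℝ) (a c : V₁) : S (r • a) c X Y = r * S a c X Y :=
    (hS X Y).smul_left r a c
  have sMr (X Y : V₂) (r : ℝ) (a c : V₁) : S a (r • c) X Y = r * S a c X Y :=
    (hS X Y).smul_right r a c
  have sZl (X Y : V₂) (c : V₁) : S 0 c X Y = 0 := (hS X Y).zero_left c
  have sZr (X Y : V₂) (c : V₁) : S c 0 X Y = 0 := (hS X Y).zero_right c
  have tMl (a b : V₁) (r : ℝ) (X Y : V₂) : S a b (r • X) Y = r * S a b X Y :=
    (hT a b).smul_left r X Y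
  have tMr (a b : V₁) (r : ℝ) (X Y : V₂) : S a b X (r • Y) = r * S a b X Y :=
    (hT a b).smul_right r X Y
  have tZl (a b : V₁) (X : V₂) : S a b 0 X = 0 := (hT a b).zero_left X
  have tZr (a b : V₁) (X : V₂) : S a b X 0 = 0 := (hT a b).zero_right X
  have o₁ (A : V₁) (hA : g₁ u₁ A = 0) : sumForm g₁ g₂ (u₁, u₂) (A, 0) = 0 := by
    simp [sumForm, hA, m₂.zero_right]
  have o₂ (Y : V₂) (hY : g₂ u₂ Y = 0) : sumForm g₁ g₂ (u₁, u₂) (0, Y) = 0 := by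
    simp [sumForm, hY, m₁.zero_right]
  -- This is the direction orthogonal to `u` in the plane of `(u₁, 0)` and `(0, u₂)`. Call it `v`;
  -- then `u ∧ v = (u₁, 0) ∧ (0, u₂)`, as the coefficient determinant is `(1 + α) - α = 1`.
  have ov : sumForm g₁ g₂ (u₁, u₂) (α • u₁, (1 + α) • u₂) = 0 := by
    simp only [sumForm, m₁.smul_right, m₂.smul_right, hβ, ← hα]
    ring
  have hne₁ : g₁ u₁ u₁ ≠ 0 := by rw [hβ]; linarith
  have hne₂ : g₂ u₂ u₂ ≠ 0 := by rw [← hα]; exact hα0.ne'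
  have w₁ := exists_split m₁ hne₁
  have w₂ := exists_split m₂ hne₂
  have α0 : α ≠ 0 := hα0.ne'
  have β0 : 1 + α ≠ 0 := by linarith
  have P₀ (A B D F) (hA : g₁ u₁ A = 0) (hB : g₁ u₁ B = 0) (hD : g₁ u₁ D = 0) (hF : g₁ u₁ F = 0) :
      P A B D F = 0 := by
    simpa [hQ.zero₁, tZl, tZr] using hO _ _ _ _ (o₁ A hA) (o₁ B hB) (o₁ D hD) (o₁ F hF)
  have Q₀ (X Y Z W) (hX : g₂ u₂ X = 0) (hY : g₂ u₂ Y = 0) (hZ : g₂ u₂ Z = 0) (hW : g₂ u₂ W = 0) :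
      Q X Y Z W = 0 := by
    simpa [hP.zero₁, sZl, sZr] using hO _ _ _ _ (o₂ X hX) (o₂ Y hY) (o₂ Z hZ) (o₂ W hW)
  have P₁ (A B D) (hA : g₁ u₁ A = 0) (hB : g₁ u₁ B = 0) (hD : g₁ u₁ D = 0) :
      P u₁ A B D = 0 := by
    simpa [hQ.zero₂, tZl, tZr, hP.smul₁, α0] using hO _ _ _ _ ov (o₁ A hA) (o₁ B hB) (o₁ D hD)
  have Q₁ (X Y Z) (hX : g₂ u₂ X = 0) (hY : g₂ u₂ Y = 0) (hZ : g₂ u₂ Z = 0) :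
      Q u₂ X Y Z = 0 := by
    simpa [hP.zero₂, sZl, sZr, hQ.smul₁, β0] using hO _ _ _ _ ov (o₂ X hX) (o₂ Y hY) (o₂ Z hZ)
  -- `C(u,A,u,B) = 0` and `C(v,A,v,B) = 0` are two linear equations in `P u₁ A u₁ B` and `S A B u₂
  -- u₂`, with determinant `(1 + α)^2 - α^2 = 1 + 2α ≠ 0`.
  have PS (A B) (hA : g₁ u₁ A = 0) (hB : g₁ u₁ B = 0) : P u₁ A u₁ B = 0 ∧ S A B u₂ u₂ = 0 := by
    have h1 := hE _ _ (o₁ A hA) (o₁ B hB)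
    have h2 := hO _ _ _ _ ov (o₁ A hA) ov (o₁ B hB)
    simp only [hQ.zero₂, tZl, tZr, hP.smul₁, hP.smul₃, tMl, tMr] at h1 h2
    have h3 : S A B u₂ u₂ * (1 + 2 * α) = 0 := by linear_combination h2 - α ^ 2 * h1
    have h4 : S A B u₂ u₂ = 0 := by
      rcases mul_eq_zero.1 h3 with h | h
      · exact h
      · linarith
    exact ⟨by linarith, h4⟩
  have QS (X Y) (hX : g₂ u₂ X = 0) (hY : g₂ u₂ Y = 0) : Q u₂ X u₂ Y = 0 ∧ S u₁ u₁ X Y = 0 := by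
    have h1 := hE _ _ (o₂ X hX) (o₂ Y hY)
    have h2 := hO _ _ _ _ ov (o₂ X hX) ov (o₂ Y hY)
    simp only [hP.zero₂, sZl, sZr, hQ.smul₁, hQ.smul₃, sMl, sMr] at h1 h2
    have h3 : Q u₂ X u₂ Y * (1 + 2 * α) = 0 := by linear_combination h2 - α ^ 2 * h1
    have h4 : Q u₂ X u₂ Y = 0 := by
      rcases mul_eq_zero.1 h3 with h | h
      · exact h
      · linarith
    exact ⟨h4, by linarith⟩
  have S₀₀ (A B X Y) (hA : g₁ u₁ A = 0) (hB : g₁ u₁ B = 0) (hX : g₂ u₂ X = 0)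
      (hY : g₂ u₂ Y = 0) : S A B X Y = 0 := by
    simpa [hP.zero₂, hQ.zero₁, sZl, sZr, tZl, tZr] using
      hO _ _ _ _ (o₁ A hA) (o₂ X hX) (o₁ B hB) (o₂ Y hY)
  have S₁₀ (A X Y) (hA : g₁ u₁ A = 0) (hX : g₂ u₂ X = 0) (hY : g₂ u₂ Y = 0) :
      S u₁ A X Y = 0 := by
    simpa [hP.zero₂, hQ.zero₃, sZl, sZr, tZl, tZr, sMl, α0] using
      hO _ _ _ _ ov (o₂ X hX) (o₁ A hA) (o₂ Y hY)
  have S₀₁ (A B Y) (hA : g₁ u₁ A = 0) (hB : g₁ u₁ B = 0) (hY : g₂ u₂ Y = 0) :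
      S A B u₂ Y = 0 := by
    simpa [hP.zero₃, hQ.zero₂, sZl, sZr, tZl, tZr, tMl, β0] using
      hO _ _ _ _ ov (o₁ A hA) (o₂ Y hY) (o₁ B hB)
  have S₁₁ (A Y) (hA : g₁ u₁ A = 0) (hY : g₂ u₂ Y = 0) : S u₁ A u₂ Y = 0 := by
    have h := hO _ _ _ _ ov (o₁ A hA) ov (o₂ Y hY)
    simp [hP.zero₄, hQ.zero₂, sZr, tZl, sMr, tMl, α0, β0] at h
    rw [(hS u₂ Y).symm, h]
  -- Since `u ∧ v = (u₁, 0) ∧ (0, u₂)`, the component `C(u,v,u,v)` is exactly `S u₁ u₁ u₂ u₂`.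
  have S₂₂ : S u₁ u₁ u₂ u₂ = 0 := by
    have h := hE _ _ ov ov
    simp only [hP.smul₂, hP.smul₄, hP.self₁₂, hQ.smul₂, hQ.smul₄, hQ.self₁₂, sMl, sMr, tMl,
      tMr] at h
    linear_combination h
  have S₁₂ (A) (hA : g₁ u₁ A = 0) : S u₁ A u₂ u₂ = 0 := by
    have h := hE _ _ ov (o₁ A hA)
    simp only [hP.smul₂, hP.self₁₂, hQ.smul₂, hQ.zero₄, sMl, tMl, tZr] at h
    linear_combination -h
  have S₂₁ (Y) (hY : g₂ u₂ Y = 0) : S u₁ u₁ u₂ Y = 0 := by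
    have h := hE _ _ ov (o₂ Y hY)
    simp only [hP.smul₂, hP.zero₄, hQ.smul₂, hQ.self₁₂, sMl, tMl, sZr] at h
    linear_combination h
  have hS0 (a b X Y) : S a b X Y = 0 :=
    (hS X Y).eq_zero_of_split w₁
      ((hT u₁ u₁).eq_zero_of_split w₂ S₂₂ S₂₁ (fun X Y hX hY ↦ (QS X Y hX hY).2) X Y)
      (fun A hA ↦ (hT u₁ A).eq_zero_of_split w₂ (S₁₂ A hA) (fun Y ↦ S₁₁ A Y hA)
        (fun X Y ↦ S₁₀ A X Y hA) X Y)
      (fun A B hA hB ↦ (hT A B).eq_zero_of_split w₂ (PS A B hA hB).2 (fun Y ↦ S₀₁ A B Y hA hB)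
        (fun X Y ↦ S₀₀ A B X Y hA hB) X Y) a b
  have hP0 := hP.eq_zero_of_split w₁ (fun A B hA hB ↦ (PS A B hA hB).1) P₁ P₀
  have hQ0 := hQ.eq_zero_of_split w₂ (fun A B hA hB ↦ (QS A B hA hB).1) Q₁ Q₀
  obtain ⟨a, X⟩ := a
  obtain ⟨b, Y⟩ := b
  obtain ⟨c, Z⟩ := c
  obtain ⟨d, W⟩ := d
  rw [hexp, hP0, hQ0, hS0, hS0, hS0, hS0]
  ring

/-- If the first factor has dimension at most two, the Weyl tensor of a direct sum can be purely
magnetic with respect to a unit timelike vector of the first factor only if it vanishes. -/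
theorem prodWeyl_eq_zero_of_finrank_le_two [FiniteDimensional ℝ V₁]
    (hV : Module.finrank ℝ V₁ ≤ 2) (H₁ : IsCurvatureAt g₁ R₁ Ric₁ s₁)
    (H₂ : IsCurvatureAt g₂ R₂ Ric₂ s₂) {n s : ℝ} (hU : g₁ U U = -1)
    (hP : IsPMForm (sumForm g₁ g₂) (prodWeyl n g₁ R₁ Ric₁ g₂ R₂ Ric₂ s) (U, 0))
    (a b c d : V₁ × V₂) : prodWeyl n g₁ R₁ Ric₁ g₂ R₂ Ric₂ s a b c d = 0 := by
  have hg := H₁.metric.sumForm H₂.metric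
  rw [isPMForm_iff hg (isCurvatureForm_weylForm hg
    (H₁.riemann.sumCurvatureForm H₂.riemann) (H₁.ricci.sumForm H₂.ricci) _ _)
    (by simp [sumForm, hU, H₂.metric.zero_left])] at hP
  obtain ⟨hE, hO⟩ := hP
  have m₁ := H₁.metric
  have m₂ := H₂.metric
  have hne : g₁ U U ≠ 0 := by rw [hU]; norm_num
  obtain ⟨K, hK⟩ := H₁.riemann.eq_const_of_finrank_le_two m₁ H₁.exists_dual hV hne
  have hRic := H₁.ricci_eq K hK
  have hexp := prodWeyl_eq (R₁ := R₁) (R₂ := R₂) m₁ H₁.ricci m₂ H₂.ricci n s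
  have hP := isCurvatureForm_weylForm m₁ H₁.riemann H₁.ricci n s
  have hQ := isCurvatureForm_weylForm m₂ H₂.riemann H₂.ricci n s
  have hS := fun X Y ↦ isSymmForm_mixedForm_left (g₂ := g₂) (Ric₂ := Ric₂) m₁ H₁.ricci n s X Y
  have hT := fun a b ↦ isSymmForm_mixedForm_right (g₁ := g₁) (Ric₁ := Ric₁) m₂ H₂.ricci n s a b
  -- With `R₁` and `Ric₁` multiples of metric expressions, the components odd in `U` vanish without
  -- using that `C` is PM; PM supplies the even ones.
  have hS₁ (A X Y) (hA : g₁ U A = 0) : mixedForm n g₁ Ric₁ g₂ Ric₂ s U A X Y = 0 := by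
    simp only [mixedForm, hRic, hA]; ring
  have hP₁ (A B D) (_ : g₁ U A = 0) (hB : g₁ U B = 0) (hD : g₁ U D = 0) :
      weylForm n g₁ R₁ Ric₁ s U A B D = 0 := by
    simp only [weylForm, hK, hRic, hB, hD, m₁.symm B U, m₁.symm D U]; ring
  set P := weylForm n g₁ R₁ Ric₁ s
  set Q := weylForm n g₂ R₂ Ric₂ s
  set S := mixedForm n g₁ Ric₁ g₂ Ric₂ s
  simp only [hexp] at hE hO
  have sZl (X Y : V₂) (c : V₁) : S 0 c X Y = 0 := (hS X Y).zero_left c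
  have sZr (X Y : V₂) (c : V₁) : S c 0 X Y = 0 := (hS X Y).zero_right c
  have tZl (a b : V₁) (X : V₂) : S a b 0 X = 0 := (hT a b).zero_left X
  have tZr (a b : V₁) (X : V₂) : S a b X 0 = 0 := (hT a b).zero_right X
  have o₁ (A : V₁) (hA : g₁ U A = 0) : sumForm g₁ g₂ (U, 0) (A, 0) = 0 := by
    simp [sumForm, hA, m₂.zero_right]
  have o₂ (Y : V₂) : sumForm g₁ g₂ (U, 0) (0, Y) = 0 := by
    simp [sumForm, m₁.zero_right, m₂.zero_left]
  have w₁ := exists_split m₁ hne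
  have hP0 : ∀ a b c d, P a b c d = 0 := by
    refine hP.eq_zero_of_split w₁ (fun A B hA hB ↦ ?_) hP₁ (fun A B D F hA hB hD hF ↦ ?_)
    · simpa [hQ.zero₁, tZl, tZr] using hE _ _ (o₁ A hA) (o₁ B hB)
    · simpa [hQ.zero₁, tZl, tZr] using hO _ _ _ _ (o₁ A hA) (o₁ B hB) (o₁ D hD) (o₁ F hF)
  have hQ0 (X Y Z W) : Q X Y Z W = 0 := by
    simpa [hP.zero₁, sZl, sZr] using hO _ _ _ _ (o₂ X) (o₂ Y) (o₂ Z) (o₂ W)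
  have hS0 (a b X Y) : S a b X Y = 0 := by
    refine (hS X Y).eq_zero_of_split w₁ ?_ (fun A hA ↦ hS₁ A X Y hA) (fun A B hA hB ↦ ?_) a b
    · simpa [hP.zero₂, hQ.zero₁, sZl, sZr, tZl, tZr] using hE _ _ (o₂ X) (o₂ Y)
    · simpa [hP.zero₂, hQ.zero₁, sZl, sZr, tZl, tZr] using
        hO _ _ _ _ (o₁ A hA) (o₂ X) (o₁ B hB) (o₂ Y)
  obtain ⟨a, X⟩ := a
  obtain ⟨b, Y⟩ := b
  obtain ⟨c, Z⟩ := c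
  obtain ⟨d, W⟩ := d
  rw [hexp, hP0, hQ0, hS0, hS0, hS0, hS0]
  ring

/-- The magnetic components of the Weyl tensor of a direct sum. -/
theorem prodWeyl_magnetic (H₁ : IsCurvatureAt g₁ R₁ Ric₁ s₁) (H₂ : IsCurvatureAt g₂ R₂ Ric₂ s₂)
    {n₁ n₂ : ℝ} (h : 4 ≤ n₁ + n₂) {A B D : V₁} (X Y Z : V₂) (hA : g₁ U A = 0) (hB : g₁ U B = 0)
    (hD : g₁ U D = 0) (s : ℝ) :
    prodWeyl (n₁ + n₂) g₁ R₁ Ric₁ g₂ R₂ Ric₂ s (U, 0) (0, X) (A, 0) (0, Y) =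
      -(1 / (n₁ + n₂ - 2)) * Ric₁ U A * g₂ X Y ∧
    (3 ≤ n₁ → prodWeyl (n₁ + n₂) g₁ R₁ Ric₁ g₂ R₂ Ric₂ s (U, 0) (A, 0) (B, 0) (D, 0) =
      weylForm n₁ g₁ R₁ Ric₁ s₁ U A B D - n₂ / ((n₁ + n₂ - 2) * (n₁ - 2)) *
        (g₁ A B * Ric₁ D U - g₁ A D * Ric₁ B U)) ∧
    prodWeyl (n₁ + n₂) g₁ R₁ Ric₁ g₂ R₂ Ric₂ s (U, 0) (0, X) (A, 0) (B, 0) = 0 ∧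
    prodWeyl (n₁ + n₂) g₁ R₁ Ric₁ g₂ R₂ Ric₂ s (U, 0) (A, 0) (B, 0) (0, X) = 0 ∧
    prodWeyl (n₁ + n₂) g₁ R₁ Ric₁ g₂ R₂ Ric₂ s (U, 0) (A, 0) (0, X) (0, Y) = 0 ∧
    prodWeyl (n₁ + n₂) g₁ R₁ Ric₁ g₂ R₂ Ric₂ s (U, 0) (0, X) (0, Y) (0, Z) = 0 := by
  have e1 : n₁ + n₂ - 2 ≠ 0 := by linarith
  have z₁ := H₁.riemann
  have z₂ := H₂.riemann
  have m₁ := H₁.metric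
  have m₂ := H₂.metric
  have r₁ := H₁.ricci
  have r₂ := H₂.ricci
  refine ⟨?_, fun h3 ↦ ?_, ?_, ?_, ?_, ?_⟩
  · simp only [weylForm, sumForm, sumCurvatureForm, z₁.zero₂, z₂.zero₁, m₁.zero_left,
      m₁.zero_right, m₂.zero_left, m₂.zero_right, r₁.zero_left, r₁.zero_right, r₂.zero_left,
      r₂.zero_right, hA, r₁.symm A U]
    ring
  -- The scalar terms drop out by orthogonality to `U`; the coefficient is `1/(n₁-2) - 1/(n₁+n₂-2)`.
  · have e2 : n₁ - 2 ≠ 0 := by linarith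
    simp only [weylForm, sumForm, sumCurvatureForm, z₂.zero₁, m₂.zero_left, r₂.zero_left, hB, hD,
      add_zero]
    field_simp
    ring
  all_goals
    simp only [weylForm, sumForm, sumCurvatureForm, z₁.zero₂, z₁.zero₃, z₁.zero₄, z₂.zero₁,
      m₁.zero_left, m₁.zero_right, m₂.zero_left, m₂.zero_right, r₁.zero_left, r₁.zero_right,
      r₂.zero_left, r₂.zero_right, hA, hB]
    ring

end AlgebraicProduct

theorem LorentzianMetric.nondegenerate {E : Type*} [NormedAddCommGroup E] [NormedSpace ℝ E]
    {H : Type*} [TopologicalSpace H] {I : ModelWithCorners ℝ E H}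
    {M : Type*} [TopologicalSpace M] [ChartedSpace H M] [IsManifold I ∞ M]
    (g : LorentzianMetric I M) (x : M) (v : TangentSpace I x)
    (hv : ∀ w, g.inner x v w = 0) : v = 0 := by
  obtain ⟨t, -, h⟩ := g.signature x
  by_contra hne
  exact (h v (by rw [g.symm, hv]) hne).ne' (hv v)

/-! ### Translation of the geometric Weyl tensor into the algebraic one. -/

section Weyl

variable {E : Type*} [NormedAddCommGroup E] [NormedSpace ℝ E] [FiniteDimensional ℝ E]
  {H : Type*} [TopologicalSpace H] {I : ModelWithCorners ℝ E H}
  {M : Type*} [TopologicalSpace M] [ChartedSpace H M]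

theorem weyl_of_finrank_le_two (h : Module.finrank ℝ E ≤ 2)
    (g : ∀ x : M, TangentSpace I x →L[ℝ] TangentSpace I x →L[ℝ] ℝ) (x : M)
    (a b c d : TangentSpace I x) : weyl g x a b c d = 0 := if_pos h

theorem weyl_eq_weylForm (h : 3 ≤ Module.finrank ℝ E)
    (g : ∀ x : M, TangentSpace I x →L[ℝ] TangentSpace I x →L[ℝ] ℝ) (x : M) :
    weyl g x = weylForm (V := E) (Module.finrank ℝ E) (fun a b ↦ g x a b) (riemann g x)
      (ricci g x) (scalarCurvature g x) := by
  ext a b c d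
  exact if_neg (by omega)

theorem isPMAt_iff (g : ∀ x : M, TangentSpace I x →L[ℝ] TangentSpace I x →L[ℝ] ℝ) (x : M)
    (u : TangentSpace I x) :
    IsPMAt g x u ↔ IsPMForm (V := E) (fun a b ↦ g x a b) (weyl g x) u := Iff.rfl

theorem isPMAt_of_finrank_le_two (h : Module.finrank ℝ E ≤ 2)
    (g : ∀ x : M, TangentSpace I x →L[ℝ] TangentSpace I x →L[ℝ] ℝ) (x : M)
    (u : TangentSpace I x) : IsPMAt g x u := fun a b c d ↦ by
  rw [weylElectric, weyl_of_finrank_le_two h, weyl_of_finrank_le_two h]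
  norm_num

end Weyl

section WeylProduct

variable {E₁ : Type*} [NormedAddCommGroup E₁] [NormedSpace ℝ E₁] [FiniteDimensional ℝ E₁]
  {H₁ : Type*} [TopologicalSpace H₁] {I₁ : ModelWithCorners ℝ E₁ H₁} [I₁.Boundaryless]
  {M₁ : Type*} [TopologicalSpace M₁] [ChartedSpace H₁ M₁] [IsManifold I₁ ∞ M₁]
  {E₂ : Type*} [NormedAddCommGroup E₂] [NormedSpace ℝ E₂] [FiniteDimensional ℝ E₂]
  {H₂ : Type*} [TopologicalSpace H₂] {I₂ : ModelWithCorners ℝ E₂ H₂} [I₂.Boundaryless]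
  {M₂ : Type*} [TopologicalSpace M₂] [ChartedSpace H₂ M₂] [IsManifold I₂ ∞ M₂]
  {g₁ : ∀ x : M₁, TangentSpace I₁ x →L[ℝ] TangentSpace I₁ x →L[ℝ] ℝ}
  {g₂ : ∀ x : M₂, TangentSpace I₂ x →L[ℝ] TangentSpace I₂ x →L[ℝ] ℝ} {p : M₁ × M₂}

theorem weyl_prodMetric (h : 3 ≤ Module.finrank ℝ E₁ + Module.finrank ℝ E₂)
    (h₁ : IsMetricNear (chartMetric g₁ p.1) (extChartAt I₁ p.1 p.1))
    (h₂ : IsMetricNear (chartMetric g₂ p.2) (extChartAt I₂ p.2 p.2)) :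
    weyl (prodMetric g₁ g₂) p = prodWeyl (V₁ := E₁) (V₂ := E₂)
      (Module.finrank ℝ E₁ + Module.finrank ℝ E₂) (fun a b ↦ g₁ p.1 a b) (riemann g₁ p.1)
      (ricci g₁ p.1) (fun a b ↦ g₂ p.2 a b) (riemann g₂ p.2) (ricci g₂ p.2)
      (scalarCurvature g₁ p.1 + scalarCurvature g₂ p.2) := by
  rw [weyl_eq_weylForm (by rwa [Module.finrank_prod]), scalarCurvature_prodMetric h₁ h₂,
    Module.finrank_prod, Nat.cast_add]
  have hR : riemann (prodMetric g₁ g₂) p =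
      sumCurvatureForm (V₁ := E₁) (V₂ := E₂) (riemann g₁ p.1) (riemann g₂ p.2) := by
    ext a b c d
    exact riemann_prodMetric h₁ h₂ a b c d
  have hRic : ricci (prodMetric g₁ g₂) p =
      sumForm (V₁ := E₁) (V₂ := E₂) (ricci g₁ p.1) (ricci g₂ p.2) := by
    ext a b
    exact ricci_prodMetric h₁ h₂ a b
  rw [hR, hRic]
  rfl

theorem isPMAt_prodMetric_iff (h : 3 ≤ Module.finrank ℝ E₁ + Module.finrank ℝ E₂)
    (h₁ : IsMetricNear (chartMetric g₁ p.1) (extChartAt I₁ p.1 p.1))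
    (h₂ : IsMetricNear (chartMetric g₂ p.2) (extChartAt I₂ p.2 p.2)) (u : E₁ × E₂) :
    IsPMAt (prodMetric g₁ g₂) p u ↔ IsPMForm (V := E₁ × E₂)
      (sumForm (fun a b : E₁ ↦ g₁ p.1 a b) (fun a b : E₂ ↦ g₂ p.2 a b))
      (prodWeyl (V₁ := E₁) (V₂ := E₂)
        (Module.finrank ℝ E₁ + Module.finrank ℝ E₂) (fun a b ↦ g₁ p.1 a b) (riemann g₁ p.1)
        (ricci g₁ p.1) (fun a b ↦ g₂ p.2 a b) (riemann g₂ p.2) (ricci g₂ p.2)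
        (scalarCurvature g₁ p.1 + scalarCurvature g₂ p.2)) u := by
  rw [← weyl_prodMetric h h₁ h₂]
  exact Iff.rfl

end WeylProduct

end PMProduct

end

/-! ### The main theorem. -/

open PMProduct in
theorem mainTheorem10 (n₁ n₂ : ℕ) (hn₂ : 1 ≤ n₂) (hn : 4 ≤ n₁ + n₂)
    {M₁ : Type*} [TopologicalSpace M₁] [ChartedSpace (EuclideanSpace ℝ (Fin n₁)) M₁]
    [IsManifold (𝓡 n₁) ∞ M₁] [Nonempty M₁]
    {M₂ : Type*} [TopologicalSpace M₂] [ChartedSpace (EuclideanSpace ℝ (Fin n₂)) M₂]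
    [IsManifold (𝓡 n₂) ∞ M₂] [Nonempty M₂]
    (g₁ : LorentzianMetric (𝓡 n₁) M₁)
    (g₂ : Bundle.ContMDiffRiemannianMetric (𝓡 n₂) ∞ (EuclideanSpace ℝ (Fin n₂))
      (fun x : M₂ ↦ TangentSpace (𝓡 n₂) x)) :
    (2 ≤ n₁ →
      ∀ U : ∀ p : M₁ × M₂, TangentSpace (𝓡 n₁) p.1,
      (∀ p, g₁.inner p.1 (U p) (U p) = -1) →
        ((∀ p, IsPMAt (prodMetric g₁.inner g₂.inner) p (liftFst p (U p))) ↔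
          ((∀ p : M₁ × M₂, IsPMAt g₁.inner p.1 (U p) ∧ HasPMRicciFormAt g₁.inner p.1 (U p)) ∧
            HasConstantCurvature g₂.inner ∧
            ∀ p : M₁ × M₂,
              (n₂ : ℝ) * ((n₂ : ℝ) - 1) * scalarCurvature g₁.inner p.1
                + (n₁ : ℝ) * ((n₁ : ℝ) - 1) * scalarCurvature g₂.inner p.2 = 0)) ∧
        ((∀ p, IsPMAt (prodMetric g₁.inner g₂.inner) p (liftFst p (U p))) →
          ∀ (p : M₁ × M₂) (A B D : TangentSpace (𝓡 n₁) p.1) (X Y Z : TangentSpace (𝓡 n₂) p.2),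
            g₁.inner p.1 (U p) A = 0 → g₁.inner p.1 (U p) B = 0 → g₁.inner p.1 (U p) D = 0 →
            weyl (prodMetric g₁.inner g₂.inner) p
                (liftFst p (U p)) (liftSnd p X) (liftFst p A) (liftSnd p Y) =
              -(1 / ((n₁ : ℝ) + (n₂ : ℝ) - 2)) * ricci g₁.inner p.1 (U p) A
                * g₂.inner p.2 X Y ∧
            (3 ≤ n₁ → weyl (prodMetric g₁.inner g₂.inner) p
                (liftFst p (U p)) (liftFst p A) (liftFst p B) (liftFst p D) =
              weyl g₁.inner p.1 (U p) A B D
                - (n₂ : ℝ) / (((n₁ : ℝ) + (n₂ : ℝ) - 2) * ((n₁ : ℝ) - 2)) *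
                  (g₁.inner p.1 A B * ricci g₁.inner p.1 D (U p)
                    - g₁.inner p.1 A D * ricci g₁.inner p.1 B (U p))) ∧
            weyl (prodMetric g₁.inner g₂.inner) p
                (liftFst p (U p)) (liftSnd p X) (liftFst p A) (liftFst p B) = 0 ∧
            weyl (prodMetric g₁.inner g₂.inner) p
                (liftFst p (U p)) (liftFst p A) (liftFst p B) (liftSnd p X) = 0 ∧
            weyl (prodMetric g₁.inner g₂.inner) p
                (liftFst p (U p)) (liftFst p A) (liftSnd p X) (liftSnd p Y) = 0 ∧
            weyl (prodMetric g₁.inner g₂.inner) p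
                (liftFst p (U p)) (liftSnd p X) (liftSnd p Y) (liftSnd p Z) = 0)) ∧
    (∀ (p : M₁ × M₂) (u : TangentSpace ((𝓡 n₁).prod (𝓡 n₂)) p),
      prodMetric g₁.inner g₂.inner p u u = -1 →
      IsProperlyPMAt (prodMetric g₁.inner g₂.inner) p u →
        3 ≤ n₁ ∧ LivesInFst p u) := by
  have hd₁ : Module.finrank ℝ (EuclideanSpace ℝ (Fin n₁)) = n₁ := finrank_euclideanSpace_fin
  have hd₂ : Module.finrank ℝ (EuclideanSpace ℝ (Fin n₂)) = n₂ := finrank_euclideanSpace_fin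
  have hM₁ (x : M₁) : IsMetricNear (chartMetric g₁.inner x) (extChartAt (𝓡 n₁) x x) :=
    isMetricNear_chartMetric g₁.contMDiff g₁.symm x (g₁.nondegenerate x)
  have hM₂ (x : M₂) : IsMetricNear (chartMetric g₂.inner x) (extChartAt (𝓡 n₂) x x) :=
    isMetricNear_chartMetric g₂.contMDiff g₂.symm x fun v hv ↦ by
      by_contra hne
      exact (g₂.pos x v hne).ne' (hv v)
  have C₁ (x : M₁) := isCurvatureAt_of_isMetricNear (hM₁ x)
  have C₂ (x : M₂) := isCurvatureAt_of_isMetricNear (hM₂ x)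
  have h3 : 3 ≤ Module.finrank ℝ (EuclideanSpace ℝ (Fin n₁))
      + Module.finrank ℝ (EuclideanSpace ℝ (Fin n₂)) := by omega
  have hW (p : M₁ × M₂) := weyl_prodMetric h3 (hM₁ p.1) (hM₂ p.2)
  have hPM (p : M₁ × M₂) := isPMAt_prodMetric_iff h3 (hM₁ p.1) (hM₂ p.2)
  refine ⟨fun h2 U hU ↦ ⟨⟨fun h ↦ ?_, ?_⟩, fun _ p A B D X Y Z hA hB hD ↦ ?_⟩, fun p u hu hPu ↦ ?_⟩
  · have hF (p : M₁ × M₂) := exists_pmFactors_of_isPMForm (by omega) (by omega) (by omega)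
      (C₁ p.1) (C₂ p.2) (hU p) (g₂.pos p.2) ((hPM p _).1 (h p))
    rw [hd₁, hd₂] at hF
    choose κ hκ using hF
    have h2' : (2 : ℝ) ≤ n₁ := by exact_mod_cast h2
    have e1 : (n₁ : ℝ) ≠ 0 := by linarith
    have e2 : (n₁ : ℝ) - 1 ≠ 0 := by linarith
    refine ⟨fun p ↦ ⟨?_, ?_⟩, ?_, fun p ↦ ?_⟩
    · rcases h2.eq_or_lt with h3 | h3
      · exact isPMAt_of_finrank_le_two (by omega) _ _ _
      · rw [isPMAt_iff, weyl_eq_weylForm (by omega), hd₁]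
        exact (hκ p).isPMForm_fst (by exact_mod_cast h3) (C₁ p.1) (hU p)
    · obtain ⟨⟨q, hq, hR⟩, hs, -⟩ := hκ p
      refine ⟨q, hq, fun a b ↦ ?_⟩
      rw [hs, hd₁, show (n₁ : ℝ) * (n₁ - 1) * κ p / n₁ = (n₁ - 1) * κ p by field_simp]
      exact hR a b
    -- At `(x₀, x)` the value of `κ` is fixed by the scalar curvature of `M₁` at `x₀`, independently
    -- of `x`. This makes the curvature of `M₂` constant without Schur's lemma, hence also for `n₂ =
    -- 2`.
    · obtain ⟨x₀⟩ : Nonempty M₁ := inferInstance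
      refine ⟨-(scalarCurvature g₁.inner x₀ / (n₁ * (n₁ - 1))), fun x a b c d ↦ ?_⟩
      obtain ⟨-, hs, -, -, hR, -⟩ := hκ (x₀, x)
      rw [show scalarCurvature g₁.inner x₀ / (n₁ * (n₁ - 1)) = κ (x₀, x) by rw [hs]; field_simp]
      exact hR a b c d
    · obtain ⟨-, hs₁, -, hs₂, -⟩ := hκ p
      rw [hs₁, hs₂]
      ring
  · rintro ⟨ha, ⟨K, hK⟩, hc⟩ p
    obtain ⟨κ, hκ⟩ := exists_pmFactors (K := K) (by omega) (by omega) (C₁ p.1) (C₂ p.2) (hU p)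
      (fun h3 ↦ by
        have := (ha p).1
        rwa [isPMAt_iff, weyl_eq_weylForm h3] at this) (ha p).2 (hK p.2)
      (by rw [hd₁, hd₂]; exact hc p)
    exact (hPM p _).2 (hκ.isPMForm (by rw [hd₁, hd₂]; exact_mod_cast hn) (C₁ p.1) (C₂ p.2) (hU p))
  · have hmag := prodWeyl_magnetic (C₁ p.1) (C₂ p.2) (n₁ := n₁) (n₂ := n₂) (by exact_mod_cast hn)
      X Y Z hA hB hD (scalarCurvature g₁.inner p.1 + scalarCurvature g₂.inner p.2)
    have hW := hW p
    rw [hd₁, hd₂] at hW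
    rw [hW]
    refine ⟨hmag.1, fun h3 ↦ ?_, hmag.2.2⟩
    rw [weyl_eq_weylForm (by omega), hd₁]
    exact hmag.2.1 (by exact_mod_cast h3)
  · obtain ⟨hPu, a, b, c, d, hne⟩ := hPu
    have hP := (hPM p u).1 hPu
    rw [hW p] at hne
    have hu₂ : (u : EuclideanSpace ℝ (Fin n₁) × EuclideanSpace ℝ (Fin n₂)).2 = 0 := by
      by_contra h0
      exact hne (prodWeyl_eq_zero_of_snd_ne_zero (C₁ p.1) (C₂ p.2) (g₂.pos p.2) hu h0 hP a b c d)
    obtain ⟨u₁, u₂⟩ : EuclideanSpace ℝ (Fin n₁) × EuclideanSpace ℝ (Fin n₂) := u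
    obtain rfl : u₂ = 0 := hu₂
    refine ⟨?_, u₁, rfl⟩
    by_contra h3
    have hu₁ : g₁.inner p.1 u₁ u₁ = -1 := by
      have : g₁.inner p.1 u₁ u₁ + g₂.inner p.2 0 0 = -1 := hu
      simpa using this
    exact hne (prodWeyl_eq_zero_of_finrank_le_two (by omega) (C₁ p.1) (C₂ p.2) hu₁ hP a b c d)
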